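/- For real $\alpha>0$, define the numbers $p_\alpha(n)$ by the formal power series identity $$\sum_{n=0}^\infty p_\alpha(n)x^n=\prod_{k=1}^\infty (1-x^k)^{-\alpha}.$$ For integers $n>\alpha/24$ and $0\le m\le \alpha/24$ put $\nu_\alpha(n):=\sqrt{n-\alpha/24}$ and $\mu_\alpha(m):=\sqrt{\alpha/24-m}$, and for $k\ge 1$ let $$A_k^{(\alpha)}(n,m):=\sum_{\substack{0\le h<k\\ \gcd(h,k)=1}} e^{\alpha\pi i\,s(h,k)+\frac{2\pi i}{k}(mH-nh)},\qquad s(h,k):=\sum_{r=1}^{k-1}\frac rk\left(\frac{hr}{k}-\left\lfloor\frac{hr}{k}\right\rfloor-\frac12\right),$$ where $H$ is an integer with $hH\equiv -1\pmod k$. Let $$I_\beta(x):=\left(\frac x2\right)^\beta\sum_{j=0}^\infty\frac{(x/2)^{2j}}{j!\,\Gamma(\beta+j+1)}$$ be the modified Bessel function of the first kind. **Theorem 1.1.** For all real $\alpha>0$ and all integers $n>\alpha/24$, $$p_\alpha(n)=\nu_\alpha(n)^{-\frac{\alpha}{2}-1}\sum_{m=0}^{\lfloor \alpha/24\rfloor}\mu_\alpha(m)^{\frac{\alpha}{2}+1}\,p_\alpha(m)\sum_{k=1}^\infty\frac{2\pi}{k}\,A_k^{(\alpha)}(n,m)\,I_{\frac{\alpha}{2}+1}\!\left(\frac{4\pi}{k}\,\nu_\alpha(n)\,\mu_\alpha(m)\right),$$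 where each of the series over $k$ converges absolutely. -/

import Mathlib

namespace FracPartition

/-- The formal power series `(1 - X ^ k) ^ (-α)` for `k ≥ 1`: the binomial series of
`(1 + X) ^ (-α)` with `-X ^ k` put in place of `X`. -/
noncomputable def eulerFactor (α : ℝ) (k : ℕ) (hk : k ≠ 0) : PowerSeries ℝ :=
  PowerSeries.expand k hk (PowerSeries.rescale (-1) (PowerSeries.binomialSeries ℝ (-α)))

open scoped PowerSeries.WithPiTopology in
/-- The infinite product below converges (unconditionally, coefficient by coefficient). -/
theorem multipliable_eulerFactor (α : ℝ) :
    Multipliable fun k : ℕ => eulerFactor α (k + 1) k.succ_ne_zero := by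
  have h : Multipliable fun k : ℕ =>
      (1 : PowerSeries ℝ) + (eulerFactor α (k + 1) k.succ_ne_zero - 1) := by
    apply PowerSeries.WithPiTopology.multipliable_one_add_of_tendsto_order_atTop_nhds_top
    refine ENat.tendsto_nhds_top_iff_natCast_lt.mpr
      (fun n => Filter.eventually_atTop.mpr ⟨n, fun m hm => ?_⟩)
    have h1 : ((m + 1 : ℕ) : ℕ∞) ≤ (eulerFactor α (m + 1) m.succ_ne_zero - 1).order := by
      refine PowerSeries.le_order _ _ fun i hi => ?_
      have hi' : i < m + 1 := by exact_mod_cast hi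
      rcases Nat.eq_zero_or_pos i with rfl | hpos
      · rw [map_sub, eulerFactor, PowerSeries.coeff_zero_eq_constantCoeff_apply,
          PowerSeries.constantCoeff_expand, ← PowerSeries.coeff_zero_eq_constantCoeff_apply,
          PowerSeries.coeff_rescale]
        simp
      · have hd : ¬ (m + 1) ∣ i := fun hd => absurd (Nat.le_of_dvd hpos hd) (by omega)
        simp [eulerFactor, PowerSeries.coeff_expand_of_not_dvd _ _ _ hd,
          PowerSeries.coeff_one, hpos.ne']
    refine lt_of_lt_of_le ?_ h1
    exact_mod_cast Nat.lt_succ_of_le hm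
  simpa using h

open scoped PowerSeries.WithPiTopology in
/-- The formal generating function `∏_{k ≥ 1} (1 - X ^ k) ^ (-α)`. -/
noncomputable def genFun (α : ℝ) : PowerSeries ℝ :=
  ∏' k : ℕ, eulerFactor α (k + 1) k.succ_ne_zero

/-- The fractional partition function `p_α(n)`. -/
noncomputable def p (α : ℝ) (n : ℕ) : ℝ :=
  PowerSeries.coeff n (genFun α)

/-- `ν_α(n) = √(n - α/24)`. -/
noncomputable def nu (α : ℝ) (n : ℕ) : ℝ := Real.sqrt ((n : ℝ) - α / 24)

/-- `μ_α(m) = √(α/24 - m)`. -/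
noncomputable def mu (α : ℝ) (m : ℕ) : ℝ := Real.sqrt (α / 24 - (m : ℝ))

/-- The Dedekind sum `s(h, k)`. -/
noncomputable def dedekindSum (h : ℤ) (k : ℕ) : ℝ :=
  ∑ r ∈ Finset.Ico 1 k,
    (r : ℝ) / k * ((h : ℝ) * r / k - (⌊(h : ℝ) * r / k⌋ : ℝ) - 1 / 2)

/-- For `h` coprime to `k ≥ 1`, the representative `H` in `{0, …, k - 1}` of the residue class
with `h * H ≡ -1` modulo `k`. -/
def negInv (h k : ℕ) : ℕ := (-(h : ZMod k)⁻¹).val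

/-- `negInv` has the property that characterises it. -/
theorem mul_negInv_modEq (h k : ℕ) (hk : k ≠ 0) (hc : h.Coprime k) :
    (h : ℤ) * negInv h k ≡ -1 [ZMOD k] := by
  have : NeZero k := ⟨hk⟩
  rw [← ZMod.intCast_eq_intCast_iff]
  have h1 := ZMod.coe_mul_inv_eq_one h hc
  simp [negInv, h1]

/-- The `α`-Kloosterman sum `A_k^(α)(n, m)`, for `k ≥ 1`. -/
noncomputable def kloosterman (α : ℝ) (k n m : ℕ) : ℂ :=
  ∑ h ∈ (Finset.range k).filter (fun h => Nat.Coprime h k),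
    Complex.exp ((α : ℂ) * Real.pi * Complex.I * (dedekindSum h k : ℂ)
      + 2 * Real.pi * Complex.I / k * ((m : ℂ) * (negInv h k : ℂ) - (n : ℂ) * (h : ℂ)))

/-- The modified Bessel function of the first kind `I_ν(x)`, for real `ν ≥ 0` and `x ≥ 0`. -/
noncomputable def besselI (ν x : ℝ) : ℝ :=
  (x / 2) ^ ν *
    ∑' j : ℕ, (x / 2) ^ (2 * j) / ((Nat.factorial j : ℝ) * Real.Gamma (ν + (j : ℝ) + 1))

/-- The term of index `k ≥ 1` of the inner series:
`(2π/k) A_k^(α)(n, m) I_{α/2+1}((4π/k) ν_α(n) μ_α(m))`. -/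
noncomputable def seriesTerm (α : ℝ) (n m k : ℕ) : ℂ :=
  2 * (Real.pi : ℂ) / (k : ℂ) * kloosterman α k n m *
    (besselI (α / 2 + 1) (4 * Real.pi / (k : ℝ) * nu α n * mu α m) : ℂ)

end FracPartition

/-!
The formula is proved by the circle method on Ford circles, and the finite form of it,
`exists_norm_p_sub_le`, has an error `O (N ^ (-α / 2))` for the partial sums over `k ≤ N`.

*Generating function.* The coefficients of the partial products are nonnegative and increase to
`p α n`, so for `|q| < 1` the formal product converges to `exp (-α ∑ log (1 - q ^ k))`
(`hasSum_p_mul_pow`). Real powers of the Euler product thus need no choice of branch beyond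
principal logarithms of its factors, whose sum is essentially a logarithm of `η`. Its behaviour
under a modular substitution (`logEta_transform`) follows from that under `τ ↦ -1 / τ`, which is
known for `η` itself, by running the Euclidean algorithm; the additive constants are Dedekind sums
because these satisfy the reciprocity law.

*Dissection.* With `q = exp (2 π i τ)`, the product of the generating function and
`exp (-2 π i n τ)` has a primitive that increases by `p α n` under `τ ↦ τ + 1`
(`exists_primitive`). Its increments along the arcs of the Ford circles with denominators at
most `N` therefore add up to `p α n` (`exists_ford_dissection`), and no contour integral over the
whole path has to be considered. In the coordinate `u = k + i t` of the circle at `h / k` the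
transformation turns the increment into a factor of modulus `1 / k` times the integral over
`-l ≤ t ≤ r` of
`u ^ (-α / 2 - 2) * exp (2 π ν² / (k u)) * exp (α π u / (12 k))` times the generating function at
`(H + i u) / k`.

*Evaluation.* The terms `m ≤ α / 24` of the last factor give, when the arc is completed to the full
vertical line, the Bessel functions: this is Laplace inversion of a power of `u`, applied to the
exponential series of the factor `exp (2 π ν² / (k u))` (`integral_eq_besselI`). The remaining terms
decay to the right, and Cauchy's theorem for a rectangle moves them away from small `u`
(`norm_integral_regularPart_le`). Both errors are `O (N ^ (-α / 2 - 1))` on each arc, since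
`l + k` and `r + k` exceed `N`; the factor `1 / k` of the arcs compensates the number of residues
`h`, and the sum over `k ≤ N` costs one more power of `N`.
-/

open Complex Filter Topology MeasureTheory
open scoped Real FourierTransform

namespace FracPartition

/-! ### The generating function as an analytic function on the unit disc -/

lemma neg_one_pow_mul_choose_neg (α : ℝ) (n : ℕ) :
    (-1) ^ n * Ring.choose (-α) n = Ring.multichoose α n := by
  rw [Ring.choose_neg', Int.negOnePow_def, Units.smul_def, zsmul_eq_mul, ← mul_assoc]
  simp [← mul_pow]

lemma multichoose_nonneg {α : ℝ} (hα : 0 ≤ α) (n : ℕ) : 0 ≤ Ring.multichoose α n := by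
  have h := Ring.factorial_nsmul_multichoose_eq_ascPochhammer α n
  rw [Polynomial.ascPochhammer_smeval_eq_eval, nsmul_eq_mul] at h
  have h1 : ∀ m : ℕ, 0 ≤ (ascPochhammer ℝ m).eval α := by
    intro m
    induction m with
    | zero => simp
    | succ m ih => rw [ascPochhammer_succ_eval]; positivity
  have h2 : (0 : ℝ) < (n.factorial : ℝ) := by positivity
  exact nonneg_of_mul_nonneg_right (h ▸ h1 n) h2

lemma coeff_eulerFactor (α : ℝ) {k : ℕ} (hk : k ≠ 0) (n : ℕ) :
    PowerSeries.coeff n (eulerFactor α k hk) =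
      if k ∣ n then Ring.multichoose α (n / k) else 0 := by
  rw [eulerFactor, PowerSeries.coeff_expand]
  split_ifs
  · simp [PowerSeries.coeff_rescale, ← neg_one_pow_mul_choose_neg]
  · rfl

lemma coeff_eulerFactor_nonneg {α : ℝ} (hα : 0 ≤ α) {k : ℕ} (hk : k ≠ 0) (n : ℕ) :
    0 ≤ PowerSeries.coeff n (eulerFactor α k hk) := by
  rw [coeff_eulerFactor]
  split_ifs
  · exact multichoose_nonneg hα _
  · exact le_rfl

/-- The binomial series: `∑ multichoose α n * q ^ n = (1 - q) ^ (-α)`. -/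
lemma hasSum_multichoose (α : ℝ) {q : ℂ} (hq : ‖q‖ < 1) :
    HasSum (fun n : ℕ => ((Ring.multichoose α n : ℝ) : ℂ) * q ^ n) (exp (-α * log (1 - q))) := by
  have h := (one_div_one_sub_cpow_hasFPowerSeriesOnBall_zero (α : ℂ)).hasSum_sub
    (y := q) (by simpa [enorm_eq_nnnorm] using! hq)
  have hne : (1 : ℂ) - q ≠ 0 := by
    intro h0
    rw [sub_eq_zero] at h0
    simp [← h0] at hq
  rw [cpow_def_of_ne_zero hne, one_div, ← exp_neg] at h
  convert! h using 1
  · ext n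
    have h1 : Ring.choose (((α : ℝ) : ℂ) + (n : ℂ) - 1) n =
        ((Ring.choose (α + (n : ℝ) - 1) n : ℝ) : ℂ) := by
      rw [ofReal_choose]
      push_cast
      rfl
    simp [h1, Ring.multichoose_eq, mul_comm]
  · congr 1
    ring

lemma hasSum_eulerFactor (α : ℝ) {k : ℕ} (hk : k ≠ 0) {q : ℂ} (hq : ‖q‖ < 1) :
    HasSum (fun n : ℕ => ((PowerSeries.coeff n (eulerFactor α k hk) : ℝ) : ℂ) * q ^ n)
      (exp (-α * log (1 - q ^ k))) := by
  have hqk : ‖q ^ k‖ < 1 := by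
    rw [norm_pow]
    exact pow_lt_one₀ (norm_nonneg _) hq hk
  have h := hasSum_multichoose α hqk
  have hinj : Function.Injective fun n : ℕ => k * n := fun a b hab =>
    Nat.eq_of_mul_eq_mul_left (Nat.pos_of_ne_zero hk) hab
  refine (hinj.hasSum_iff ?_).mp ?_
  · intro x hx
    rw [coeff_eulerFactor, if_neg]
    · simp
    · rintro ⟨d, rfl⟩
      exact hx ⟨d, rfl⟩
  · convert! h using 2 with n
    simp [coeff_eulerFactor, Nat.mul_div_cancel_left _ (Nat.pos_of_ne_zero hk), pow_mul]

/-- The product of the first `K` factors of the generating function. -/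
noncomputable def partialGenFun (α : ℝ) (K : ℕ) : PowerSeries ℝ :=
  ∏ k ∈ Finset.range K, eulerFactor α (k + 1) k.succ_ne_zero

lemma partialGenFun_succ (α : ℝ) (K : ℕ) :
    partialGenFun α (K + 1) = partialGenFun α K * eulerFactor α (K + 1) K.succ_ne_zero :=
  Finset.prod_range_succ _ _

lemma coeff_partialGenFun_nonneg {α : ℝ} (hα : 0 ≤ α) (K n : ℕ) :
    0 ≤ PowerSeries.coeff n (partialGenFun α K) := by
  induction K generalizing n with
  | zero =>
    simp only [partialGenFun, Finset.range_zero, Finset.prod_empty, PowerSeries.coeff_one]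
    split_ifs <;> norm_num
  | succ K ih =>
    rw [partialGenFun_succ, PowerSeries.coeff_mul]
    exact Finset.sum_nonneg fun x _ => mul_nonneg (ih _) (coeff_eulerFactor_nonneg hα _ _)

lemma coeff_partialGenFun_le_succ {α : ℝ} (hα : 0 ≤ α) (K n : ℕ) :
    PowerSeries.coeff n (partialGenFun α K) ≤ PowerSeries.coeff n (partialGenFun α (K + 1)) := by
  rw [partialGenFun_succ, PowerSeries.coeff_mul]
  refine le_trans ?_ (Finset.single_le_sum
    (f := fun x : ℕ × ℕ => PowerSeries.coeff x.1 (partialGenFun α K) *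
      PowerSeries.coeff x.2 (eulerFactor α (K + 1) K.succ_ne_zero))
    (fun x _ => mul_nonneg (coeff_partialGenFun_nonneg hα _ _) (coeff_eulerFactor_nonneg hα _ _))
    (show ((n, 0) : ℕ × ℕ) ∈ Finset.HasAntidiagonal.antidiagonal n by simp))
  simp [coeff_eulerFactor]

lemma coeff_partialGenFun_succ_of_le (α : ℝ) {K n : ℕ} (h : n ≤ K) :
    PowerSeries.coeff n (partialGenFun α (K + 1)) = PowerSeries.coeff n (partialGenFun α K) := by
  rw [partialGenFun_succ, PowerSeries.coeff_mul, Finset.sum_eq_single (n, 0)]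
  · simp [coeff_eulerFactor]
  · rintro ⟨a, b⟩ hab hne
    rw [Finset.HasAntidiagonal.mem_antidiagonal] at hab
    have hb : b ≠ 0 := by
      rintro rfl
      exact hne (by simpa using hab)
    have hnd : ¬ (K + 1 ∣ b) := fun hd => by
      have := Nat.le_of_dvd (Nat.pos_of_ne_zero hb) hd
      simp only at hab
      omega
    simp [coeff_eulerFactor, hnd]
  · simp

lemma coeff_partialGenFun_eq (α : ℝ) {K n : ℕ} (h : n ≤ K) :
    PowerSeries.coeff n (partialGenFun α K) = PowerSeries.coeff n (partialGenFun α n) := by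
  induction K, h using Nat.le_induction with
  | base => rfl
  | succ K hK ih => rw [coeff_partialGenFun_succ_of_le α hK, ih]

open scoped PowerSeries.WithPiTopology in
lemma p_eq_coeff_partialGenFun (α : ℝ) {K n : ℕ} (h : n ≤ K) :
    p α n = PowerSeries.coeff n (partialGenFun α K) := by
  have h1 := (multipliable_eulerFactor α).hasProd.tendsto_prod_nat
  have h2 := ((PowerSeries.WithPiTopology.continuous_coeff ℝ n).tendsto _).comp h1
  refine tendsto_nhds_unique h2 (tendsto_atTop_of_eventually_const (i₀ := n) fun i hi => ?_)
  change PowerSeries.coeff n (partialGenFun α i) = _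
  rw [coeff_partialGenFun_eq α hi, coeff_partialGenFun_eq α h]

lemma p_nonneg {α : ℝ} (hα : 0 ≤ α) (n : ℕ) : 0 ≤ p α n := by
  rw [p_eq_coeff_partialGenFun α le_rfl]
  exact coeff_partialGenFun_nonneg hα _ _

lemma coeff_partialGenFun_le_p {α : ℝ} (hα : 0 ≤ α) (K n : ℕ) :
    PowerSeries.coeff n (partialGenFun α K) ≤ p α n := by
  rcases le_total n K with h | h
  · exact (p_eq_coeff_partialGenFun α h).ge
  · rw [p_eq_coeff_partialGenFun α le_rfl]
    exact monotone_nat_of_le_succ (f := fun K => PowerSeries.coeff n (partialGenFun α K))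
      (fun K => coeff_partialGenFun_le_succ hα K n) h

lemma hasSum_partialGenFun (α : ℝ) (K : ℕ) {q : ℂ} (hq : ‖q‖ < 1) :
    HasSum (fun n : ℕ => ((PowerSeries.coeff n (partialGenFun α K) : ℝ) : ℂ) * q ^ n)
      (exp (-α * ∑ k ∈ Finset.range K, log (1 - q ^ (k + 1)))) := by
  induction K with
  | zero =>
    convert! hasSum_ite_eq 0 (1 : ℂ) using 2 with n
    · rcases eq_or_ne n 0 with rfl | hn
      · simp [partialGenFun]
      · simp [partialGenFun, PowerSeries.coeff_one, hn]
    · simp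
  | succ K ih =>
    have h2 := hasSum_eulerFactor α K.succ_ne_zero hq
    have hs := summable_norm_sum_mul_antidiagonal_of_summable_norm ih.summable.norm
      h2.summable.norm
    have ht := tsum_mul_tsum_eq_tsum_sum_antidiagonal_of_summable_norm ih.summable.norm
      h2.summable.norm
    rw [ih.tsum_eq, h2.tsum_eq] at ht
    have h3 := hs.of_norm.hasSum
    rw [← ht, ← exp_add, ← mul_add, ← Finset.sum_range_succ (fun k => log (1 - q ^ (k + 1)))] at h3
    convert! h3 using 2 with n
    rw [partialGenFun_succ, PowerSeries.coeff_mul]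
    push_cast
    rw [Finset.sum_mul]
    refine Finset.sum_congr rfl fun x hx => ?_
    rw [← Finset.HasAntidiagonal.mem_antidiagonal.mp hx, pow_add]
    ring

lemma summable_log_one_sub_pow {q : ℂ} (hq : ‖q‖ < 1) :
    Summable fun k : ℕ => log (1 - q ^ (k + 1)) := by
  have : Summable fun k : ℕ => -q ^ (k + 1) :=
    ((summable_nat_add_iff 1).mpr (summable_geometric_of_norm_lt_one (x := q) hq)).neg
  simpa [sub_eq_add_neg] using summable_log_one_add_of_summable this

lemma tendsto_exp_sum_log_one_sub_pow (α : ℝ) {q : ℂ} (hq : ‖q‖ < 1) :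
    Tendsto (fun K : ℕ => exp (-α * ∑ k ∈ Finset.range K, log (1 - q ^ (k + 1))))
      atTop (𝓝 (exp (-α * ∑' k : ℕ, log (1 - q ^ (k + 1))))) := by
  have h := (summable_log_one_sub_pow hq).hasSum.tendsto_sum_nat
  exact (continuous_exp.tendsto _).comp (h.const_mul (-α : ℂ))

lemma summable_p_mul_pow {α : ℝ} (hα : 0 ≤ α) {x : ℝ} (hx0 : 0 ≤ x) (hx : x < 1) :
    Summable fun n : ℕ => p α n * x ^ n := by
  have hq : ‖(x : ℂ)‖ < 1 := by simpa [abs_of_nonneg hx0]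
  -- The partial products at `x` converge, hence are bounded.
  have hlim := (tendsto_exp_sum_log_one_sub_pow α hq).norm
  obtain ⟨B, hB⟩ := hlim.bddAbove_range
  refine summable_of_sum_range_le (c := B) (fun n => mul_nonneg (p_nonneg hα n) (pow_nonneg hx0 n))
    fun M => ?_
  have hM := hasSum_partialGenFun α M hq
  have hre : HasSum (fun n : ℕ => PowerSeries.coeff n (partialGenFun α M) * x ^ n)
      (exp (-α * ∑ k ∈ Finset.range M, log (1 - (x : ℂ) ^ (k + 1)))).re := by
    have := hasSum_re hM
    convert! this using 2 with n
    rw [← ofReal_pow, ← ofReal_mul, ofReal_re]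
  calc ∑ n ∈ Finset.range M, p α n * x ^ n
      = ∑ n ∈ Finset.range M, PowerSeries.coeff n (partialGenFun α M) * x ^ n :=
        Finset.sum_congr rfl fun n hn => by
          rw [p_eq_coeff_partialGenFun α (Finset.mem_range.mp hn).le]
    _ ≤ _ := sum_le_hasSum _ (fun n _ => mul_nonneg (coeff_partialGenFun_nonneg hα _ _)
        (pow_nonneg hx0 n)) hre
    _ ≤ _ := re_le_norm _
    _ ≤ B := hB ⟨M, rfl⟩

/-- The formal generating function converges on the open unit disc to
`∏ (1 - q ^ k) ^ (-α)`, the power being taken through the principal logarithms of the factors. -/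
theorem hasSum_p_mul_pow {α : ℝ} (hα : 0 ≤ α) {q : ℂ} (hq : ‖q‖ < 1) :
    HasSum (fun n : ℕ => (p α n : ℂ) * q ^ n)
      (exp (-α * ∑' k : ℕ, log (1 - q ^ (k + 1)))) := by
  have hb := summable_p_mul_pow hα (norm_nonneg q) hq
  have h1 : Tendsto (fun K : ℕ => ∑' n : ℕ,
      ((PowerSeries.coeff n (partialGenFun α K) : ℝ) : ℂ) * q ^ n) atTop
      (𝓝 (∑' n : ℕ, (p α n : ℂ) * q ^ n)) := by
    refine tendsto_tsum_of_dominated_convergence hb (fun n => ?_) (Eventually.of_forall fun K n => ?_)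
    · refine tendsto_atTop_of_eventually_const (i₀ := n) fun i hi => ?_
      simp only [p_eq_coeff_partialGenFun α hi]
    · rw [norm_mul, norm_pow, norm_real, Real.norm_of_nonneg (coeff_partialGenFun_nonneg hα _ _)]
      gcongr
      exact coeff_partialGenFun_le_p hα _ _
  have h2 := tendsto_exp_sum_log_one_sub_pow α hq
  simp_rw [(hasSum_partialGenFun α _ hq).tsum_eq] at h1
  rw [tendsto_nhds_unique h2 h1]
  refine Summable.hasSum (Summable.of_norm (hb.congr fun n => ?_))
  rw [norm_mul, norm_pow, norm_real, Real.norm_of_nonneg (p_nonneg hα n)]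

/-! ### Dedekind sums and their reciprocity law -/

lemma floor_mul_div (h : ℤ) (r k : ℕ) : ⌊(h : ℝ) * r / k⌋ = h * r / (k : ℤ) := by
  rw [Int.floor_div_natCast]
  congr 1
  exact_mod_cast Int.floor_intCast (R := ℝ) (h * r)

lemma dedekindSum_eq_of_modEq {h h' : ℤ} {k : ℕ} (hk : 0 < k) (hh : h ≡ h' [ZMOD k]) :
    dedekindSum h k = dedekindSum h' k := by
  obtain ⟨m, hm⟩ := hh.symm.dvd
  obtain rfl : h = h' + k * m := by linarith
  refine Finset.sum_congr rfl fun r _ => ?_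
  have : ((h' + k * m : ℤ) : ℝ) * r / k = (h' : ℝ) * r / k + ((m * r : ℤ) : ℝ) := by
    push_cast
    field_simp
  rw [this, Int.floor_add_intCast]
  push_cast
  ring

lemma dedekindSum_neg {h : ℤ} {k : ℕ} (hc : IsCoprime h k) :
    dedekindSum (-h) k = -dedekindSum h k := by
  rw [dedekindSum, dedekindSum, ← Finset.sum_neg_distrib]
  refine Finset.sum_congr rfl fun r hr => ?_
  rw [Finset.mem_Ico] at hr
  have hnd : ¬ (k : ℤ) ∣ h * r := fun hd => by
    have h1 := hc.symm.dvd_of_dvd_mul_left hd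
    have h2 := Int.le_of_dvd (by omega) h1
    omega
  rw [floor_mul_div, floor_mul_div, neg_mul, Int.neg_ediv, if_neg hnd,
    Int.sign_eq_one_of_pos (by omega)]
  push_cast
  ring

lemma dedekindSum_natCast (h k : ℕ) :
    dedekindSum h k = (h : ℝ) / k ^ 2 * ∑ r ∈ Finset.range k, (r : ℝ) ^ 2
      - 1 / k * ∑ r ∈ Finset.range k, (r : ℝ) * ((h * r / k : ℕ) : ℝ)
      - 1 / (2 * k) * ∑ r ∈ Finset.range k, (r : ℝ) := by
  have h1 : dedekindSum h k = ∑ r ∈ Finset.range k,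
      (r : ℝ) / k * ((h : ℝ) * r / k - ((h * r / k : ℕ) : ℝ) - 1 / 2) := by
    rcases Nat.eq_zero_or_pos k with rfl | hk
    · simp [dedekindSum]
    rw [dedekindSum, Finset.range_eq_Ico, Finset.sum_eq_sum_Ico_succ_bot hk]
    simp only [Nat.cast_zero, zero_div, zero_mul, zero_add]
    refine Finset.sum_congr rfl fun r _ => ?_
    have hf : (((h : ℤ) * r / (k : ℤ) : ℤ) : ℝ) = ((h * r / k : ℕ) : ℝ) := by
      rw [← Int.natCast_mul, ← Int.natCast_div, Int.cast_natCast]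
    rw [floor_mul_div, hf, Int.cast_natCast]
  rw [h1, Finset.mul_sum, Finset.mul_sum, Finset.mul_sum, ← Finset.sum_sub_distrib,
    ← Finset.sum_sub_distrib]
  refine Finset.sum_congr rfl fun r _ => ?_
  rcases Nat.eq_zero_or_pos k with rfl | hk
  · simp
  field_simp

/-- Multiplication by a unit permutes the residues modulo `k`. -/
lemma sum_mul_mod {h k : ℕ} (hk : 0 < k) (hc : h.Coprime k) (g : ℕ → ℝ) :
    ∑ r ∈ Finset.range k, g (h * r % k) = ∑ r ∈ Finset.range k, g r := by
  have hinj : Set.InjOn (fun r => h * r % k) (Finset.range k : Set ℕ) := by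
    intro a ha b hb hab
    simp only [Finset.coe_range, Set.mem_Iio] at ha hb
    have : a ≡ b [MOD k] := Nat.ModEq.cancel_left_of_coprime hc.symm hab
    rwa [Nat.ModEq, Nat.mod_eq_of_lt ha, Nat.mod_eq_of_lt hb] at this
  have himg : (Finset.range k).image (fun r => h * r % k) = Finset.range k := by
    refine Finset.eq_of_subset_of_card_le (fun x hx => ?_) ?_
    · obtain ⟨r, _, rfl⟩ := Finset.mem_image.mp hx
      exact Finset.mem_range.mpr (Nat.mod_lt _ hk)
    · rw [Finset.card_image_of_injOn hinj]
  conv_rhs => rw [← himg]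
  rw [Finset.sum_image hinj]

lemma sum_range_cast (k : ℕ) : ∑ r ∈ Finset.range k, (r : ℝ) = k * (k - 1) / 2 := by
  induction k with
  | zero => simp
  | succ k ih => rw [Finset.sum_range_succ, ih]; push_cast; ring

lemma sum_range_cast_sq (k : ℕ) :
    ∑ r ∈ Finset.range k, (r : ℝ) ^ 2 = k * (k - 1) * (2 * k - 1) / 6 := by
  induction k with
  | zero => simp
  | succ k ih => rw [Finset.sum_range_succ, ih]; push_cast; ring

/-- Lattice points under the line of slope `h / k`, counted by rows and by columns, each row `j`
with the weight `2 * j`. -/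
lemma sum_floor_mul_floor_add_one {h k : ℕ} (hh : 0 < h) (hk : 0 < k) (hc : h.Coprime k) :
    ∑ r ∈ Finset.range k, ((h * r / k : ℕ) : ℝ) * (((h * r / k : ℕ) : ℝ) + 1) =
      ∑ j ∈ Finset.range h, 2 * (j : ℝ) * ((k : ℝ) - 1 - ((k * j / h : ℕ) : ℝ)) := by
  have h1 : ∀ r ∈ Finset.range k, ((h * r / k : ℕ) : ℝ) * (((h * r / k : ℕ) : ℝ) + 1) =
      ∑ j ∈ Finset.range h, if j ≤ h * r / k then 2 * (j : ℝ) else 0 := by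
    intro r hr
    have hlt : h * r / k < h := by
      rw [Nat.div_lt_iff_lt_mul hk]
      exact Nat.mul_lt_mul_of_pos_left (Finset.mem_range.mp hr) hh
    rw [← Finset.sum_filter]
    have : (Finset.range h).filter (fun j => j ≤ h * r / k) = Finset.range (h * r / k + 1) := by
      ext j
      simp only [Finset.mem_filter, Finset.mem_range]
      omega
    rw [this, ← Finset.mul_sum, sum_range_cast]
    push_cast
    ring
  rw [Finset.sum_congr rfl h1, Finset.sum_comm]
  refine Finset.sum_congr rfl fun j hj => ?_
  rw [Finset.mem_range] at hj
  rcases Nat.eq_zero_or_pos j with rfl | hj0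
  · simp
  rw [← Finset.sum_filter]
  have hlt : k * j / h < k := by
    rw [Nat.div_lt_iff_lt_mul hh]
    exact Nat.mul_lt_mul_of_pos_left hj hk
  have : (Finset.range k).filter (fun r => j ≤ h * r / k) = Finset.Ico (k * j / h + 1) k := by
    ext r
    simp only [Finset.mem_filter, Finset.mem_range, Finset.mem_Ico]
    rw [Nat.le_div_iff_mul_le hk, Nat.succ_le_iff, Nat.div_lt_iff_lt_mul hh, and_comm]
    refine and_congr_left fun _ => ⟨fun hle => lt_of_le_of_ne (by linarith) fun heq => ?_,
      fun hlt => by linarith⟩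
    -- no lattice point lies on the line itself
    have hd : h ∣ k * j := heq ▸ dvd_mul_left h r
    exact absurd (Nat.le_of_dvd hj0 (hc.dvd_of_dvd_mul_left hd)) (by omega)
  rw [this, Finset.sum_const, Nat.card_Ico, nsmul_eq_mul, Nat.cast_sub (by omega)]
  push_cast
  ring

/-- The reciprocity law. The sum of the squares of the residues of `h * r` modulo `k` is evaluated
twice: by permuting the residues, and by expanding `h * r - k * ⌊h * r / k⌋`, where the squares of
the floors are converted by counting lattice points. -/
theorem dedekindSum_reciprocity {h k : ℕ} (hh : 0 < h) (hk : 0 < k) (hc : h.Coprime k) :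
    dedekindSum h k + dedekindSum k h =
      ((h : ℝ) ^ 2 + (k : ℝ) ^ 2 + 1) / (12 * h * k) - 1 / 4 := by
  have hmod : ∀ r : ℕ, ((h * r % k : ℕ) : ℝ) = h * r - k * ((h * r / k : ℕ) : ℝ) := by
    intro r
    have := Nat.div_add_mod (h * r) k
    have h2 : ((k * (h * r / k) + h * r % k : ℕ) : ℝ) = ((h * r : ℕ) : ℝ) := by rw [this]
    push_cast at h2 ⊢
    linarith
  have e1 := sum_mul_mod hk hc fun r => (r : ℝ)
  have e2 := sum_mul_mod hk hc fun r => (r : ℝ) ^ 2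
  have e3 := sum_floor_mul_floor_add_one hh hk hc
  simp only [hmod] at e1 e2
  rw [dedekindSum_natCast, dedekindSum_natCast]
  have e1' : ∑ r ∈ Finset.range k, ((h : ℝ) * r - k * ((h * r / k : ℕ) : ℝ)) =
      h * ∑ r ∈ Finset.range k, (r : ℝ) - k * ∑ r ∈ Finset.range k, ((h * r / k : ℕ) : ℝ) := by
    rw [Finset.mul_sum, Finset.mul_sum, ← Finset.sum_sub_distrib]
  have e2' : ∑ r ∈ Finset.range k, ((h : ℝ) * r - k * ((h * r / k : ℕ) : ℝ)) ^ 2 =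
      h ^ 2 * ∑ r ∈ Finset.range k, (r : ℝ) ^ 2
        - 2 * h * k * ∑ r ∈ Finset.range k, (r : ℝ) * ((h * r / k : ℕ) : ℝ)
        + k ^ 2 * ∑ r ∈ Finset.range k, ((h * r / k : ℕ) : ℝ) ^ 2 := by
    rw [Finset.mul_sum, Finset.mul_sum, Finset.mul_sum, ← Finset.sum_sub_distrib,
      ← Finset.sum_add_distrib]
    exact Finset.sum_congr rfl fun r _ => by ring
  have e3' : ∑ r ∈ Finset.range k, ((h * r / k : ℕ) : ℝ) * (((h * r / k : ℕ) : ℝ) + 1) =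
      ∑ r ∈ Finset.range k, ((h * r / k : ℕ) : ℝ) ^ 2
        + ∑ r ∈ Finset.range k, ((h * r / k : ℕ) : ℝ) := by
    rw [← Finset.sum_add_distrib]
    exact Finset.sum_congr rfl fun r _ => by ring
  have e3'' : ∑ j ∈ Finset.range h, 2 * (j : ℝ) * ((k : ℝ) - 1 - ((k * j / h : ℕ) : ℝ)) =
      2 * (k - 1) * ∑ j ∈ Finset.range h, (j : ℝ)
        - 2 * ∑ j ∈ Finset.range h, (j : ℝ) * ((k * j / h : ℕ) : ℝ) := by
    rw [Finset.mul_sum, Finset.mul_sum, ← Finset.sum_sub_distrib]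
    exact Finset.sum_congr rfl fun r _ => by ring
  rw [e1'] at e1
  rw [e2'] at e2
  rw [e3', e3''] at e3
  rw [sum_range_cast] at e1 e3
  rw [sum_range_cast_sq] at e2
  rw [sum_range_cast, sum_range_cast, sum_range_cast_sq, sum_range_cast_sq]
  generalize ∑ r ∈ Finset.range k, ((h * r / k : ℕ) : ℝ) ^ 2 = S2 at *
  generalize ∑ r ∈ Finset.range k, ((h * r / k : ℕ) : ℝ) = S1 at *
  generalize ∑ r ∈ Finset.range k, (r : ℝ) * ((h * r / k : ℕ) : ℝ) = A at *
  generalize ∑ j ∈ Finset.range h, (j : ℝ) * ((k * j / h : ℕ) : ℝ) = B at *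
  have hh' : (h : ℝ) ≠ 0 := by positivity
  have hk' : (k : ℝ) ≠ 0 := by positivity
  have s1 : S1 = (h - 1) * (k - 1) / 2 := by
    apply mul_left_cancel₀ hk'
    linarith
  subst s1
  have s2 : S2 = 2 * (k - 1) * ((h : ℝ) * (h - 1) / 2) - 2 * B - (h - 1) * (k - 1) / 2 := by
    linarith
  subst s2
  have a1 : A = (h ^ 2 * (k * (k - 1) * (2 * k - 1) / 6)
      + k ^ 2 * (2 * (k - 1) * ((h : ℝ) * (h - 1) / 2) - 2 * B - (h - 1) * (k - 1) / 2)
      - k * (k - 1) * (2 * k - 1) / 6) / (2 * h * k) := by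
    rw [eq_div_iff (by positivity)]
    linarith
  subst a1
  field_simp
  ring

/-! ### The logarithm of the eta function and its modular transformation -/

/-- `∑ log (1 - q ^ k)` over `k ≥ 1`, for `q = exp (2 π i τ)`. -/
noncomputable def logEuler (τ : ℂ) : ℂ :=
  ∑' k : ℕ, log (1 - exp (2 * π * I * τ) ^ (k + 1))

/-- The branch of `log η` on the upper half-plane given by summing principal logarithms of the
factors of the product. -/
noncomputable def logEta (τ : ℂ) : ℂ := π * I * τ / 12 + logEuler τ

lemma norm_exp_two_pi_I_mul (τ : ℂ) :
    ‖exp (2 * π * I * τ)‖ = Real.exp (-(2 * π * τ.im)) := by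
  rw [norm_exp]
  congr 1
  simp

lemma norm_exp_two_pi_I_mul_lt_one {τ : ℂ} (hτ : 0 < τ.im) : ‖exp (2 * π * I * τ)‖ < 1 := by
  rw [norm_exp_two_pi_I_mul, Real.exp_lt_one_iff]
  have := Real.pi_pos
  nlinarith [mul_pos this hτ]

lemma exp_two_pi_I_mul_add_intCast (τ : ℂ) (n : ℤ) :
    exp (2 * π * I * (τ + n)) = exp (2 * π * I * τ) := by
  rw [mul_add, mul_comm (2 * π * I) (n : ℂ)]
  exact exp_periodic.int_mul n _

lemma logEuler_add_intCast (τ : ℂ) (n : ℤ) : logEuler (τ + n) = logEuler τ := by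
  simp only [logEuler, exp_two_pi_I_mul_add_intCast]

lemma logEta_add_intCast (τ : ℂ) (n : ℤ) : logEta (τ + n) = logEta τ + π * I * n / 12 := by
  rw [logEta, logEta, logEuler_add_intCast]
  ring

lemma differentiableOn_tsum_log_one_sub_pow :
    DifferentiableOn ℂ (fun q : ℂ => ∑' k : ℕ, log (1 - q ^ (k + 1))) (Metric.ball 0 1) := by
  intro q hq
  rw [mem_ball_zero_iff] at hq
  obtain ⟨ρ, hqρ, hρ⟩ := exists_between hq
  have hρ0 : 0 < ρ := (norm_nonneg q).trans_lt hqρ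
  have hlt : ∀ w ∈ Metric.ball (0 : ℂ) ρ, ∀ k : ℕ, ‖w ^ (k + 1)‖ ≤ ρ ^ (k + 1) := by
    intro w hw k
    rw [norm_pow]
    exact pow_le_pow_left₀ (norm_nonneg _) (mem_ball_zero_iff.mp hw).le _
  have hpow : ∀ k : ℕ, ρ ^ (k + 1) ≤ ρ := fun k =>
    pow_le_of_le_one hρ0.le hρ.le k.succ_ne_zero
  have hd : DifferentiableOn ℂ (fun q : ℂ => ∑' k : ℕ, log (1 - q ^ (k + 1)))
      (Metric.ball 0 ρ) := by
    refine differentiableOn_tsum_of_summable_norm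
      (u := fun k : ℕ => ((1 - ρ)⁻¹ / 2 + 1) * ρ ^ (k + 1)) ?_ (fun k => ?_) Metric.isOpen_ball
      fun k w hw => ?_
    · exact ((summable_nat_add_iff 1).mpr
        (summable_geometric_of_lt_one hρ0.le hρ)).mul_left _
    · refine DifferentiableOn.clog (by fun_prop) fun w hw => ?_
      rw [sub_eq_add_neg]
      apply mem_slitPlane_of_norm_lt_one
      rw [norm_neg]
      exact ((hlt w hw k).trans (hpow k)).trans_lt hρ
    · have h1 := (hlt w hw k).trans (hpow k)
      have h2 := norm_log_one_add_le (z := -w ^ (k + 1)) (by rw [norm_neg]; linarith)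
      rw [norm_neg, ← sub_eq_add_neg] at h2
      refine h2.trans ?_
      have h3 : (1 - ‖w ^ (k + 1)‖)⁻¹ ≤ (1 - ρ)⁻¹ :=
        inv_anti₀ (by linarith) (by linarith)
      have h4 : 0 ≤ (1 - ρ)⁻¹ := inv_nonneg.mpr (by linarith)
      have h5 : ‖w ^ (k + 1)‖ ^ 2 ≤ ρ ^ (k + 1) := by
        nlinarith [norm_nonneg (w ^ (k + 1)), hlt w hw k]
      calc ‖w ^ (k + 1)‖ ^ 2 * (1 - ‖w ^ (k + 1)‖)⁻¹ / 2 + ‖w ^ (k + 1)‖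
          ≤ ρ ^ (k + 1) * (1 - ρ)⁻¹ / 2 + ρ ^ (k + 1) := by
            gcongr
            · exact inv_nonneg.mpr (by linarith)
            · exact hlt w hw k
        _ = _ := by ring
  exact (hd.differentiableAt (Metric.isOpen_ball.mem_nhds
    (mem_ball_zero_iff.mpr hqρ))).differentiableWithinAt

lemma differentiableAt_logEuler {τ : ℂ} (hτ : 0 < τ.im) : DifferentiableAt ℂ logEuler τ := by
  have h := differentiableOn_tsum_log_one_sub_pow.differentiableAt (Metric.isOpen_ball.mem_nhds
    (mem_ball_zero_iff.mpr (norm_exp_two_pi_I_mul_lt_one hτ)))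
  exact h.comp (f := fun τ : ℂ => exp (2 * π * I * τ)) τ (by fun_prop)

lemma differentiableAt_logEta {τ : ℂ} (hτ : 0 < τ.im) : DifferentiableAt ℂ logEta τ :=
  DifferentiableAt.add (by fun_prop) (differentiableAt_logEuler hτ)

lemma exp_logEta {τ : ℂ} (hτ : 0 < τ.im) : exp (logEta τ) = ModularForm.eta τ := by
  have hq := norm_exp_two_pi_I_mul_lt_one hτ
  rw [logEta, exp_add, logEuler, cexp_tsum_eq_tprod ?_ (summable_log_one_sub_pow hq),
    ModularForm.eta]
  · congr 1
    · rw [Function.Periodic.qParam]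
      congr 1
      push_cast
      ring
    · simp only [ModularForm.eta_q_eq_pow]
  · intro k
    rw [← ModularForm.eta_q_eq_pow]
    exact ModularForm.one_sub_eta_q_ne_zero k hτ

lemma im_neg_one_div_pos {τ : ℂ} (hτ : 0 < τ.im) : 0 < (-1 / τ).im := by
  rw [neg_div, one_div, neg_im, inv_im, neg_div, neg_neg]
  exact div_pos hτ (normSq_pos.mpr fun h => by simp [h] at hτ)

lemma div_I_mem_slitPlane {τ : ℂ} (hτ : 0 < τ.im) : τ / I ∈ slitPlane := by
  rw [mem_slitPlane_iff]
  left
  simpa [div_I] using hτ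

/-- The inversion `τ ↦ -1 / τ`. The exponentials of the two sides agree by the transformation
of `η`, so that their difference is constant, and it vanishes at the fixed point `i`. -/
theorem logEta_neg_one_div {τ : ℂ} (hτ : 0 < τ.im) :
    logEta (-1 / τ) = logEta τ + log (τ / I) / 2 := by
  let D : ℂ → ℂ := fun τ => logEta (-1 / τ) - logEta τ - log (τ / I) / 2
  have hne : ∀ z : ℂ, 0 < z.im → z ≠ 0 := fun z hz h => by simp [h] at hz
  have hopen : IsOpen {z : ℂ | 0 < z.im} := isOpen_lt continuous_const continuous_im
  have hdiff : ∀ z : ℂ, 0 < z.im → DifferentiableAt ℂ D z := by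
    intro z hz
    have h1 : DifferentiableAt ℂ (fun w : ℂ => -1 / w) z :=
      (differentiableAt_const _).div differentiableAt_id (hne z hz)
    have h2 : DifferentiableAt ℂ (fun w => logEta (-1 / w)) z :=
      (differentiableAt_logEta (im_neg_one_div_pos hz)).comp z h1
    have h3 : DifferentiableAt ℂ (fun w : ℂ => log (w / I)) z :=
      DifferentiableAt.clog (by fun_prop) (div_I_mem_slitPlane hz)
    exact (h2.sub (differentiableAt_logEta hz)).sub (h3.div_const 2)
  have hexp : ∀ z : ℂ, 0 < z.im → exp (D z) = 1 := by
    intro z hz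
    have hs := ModularForm.eta_comp_eq_csqrt_I_inv (x := z) hz
    simp only [Function.comp_apply, Pi.smul_apply, Pi.mul_apply, smul_eq_mul] at hs
    have hlog : log z = log (z / I) + log I := by
      rw [← log_mul (div_ne_zero (hne z hz) I_ne_zero) I_ne_zero, div_mul_cancel₀ _ I_ne_zero]
      have hre : 0 < (z / I).re := by simpa [div_I] using hz
      have h1 := abs_lt.mp (abs_arg_lt_pi_div_two_iff.mpr (Or.inl hre))
      rw [arg_I]
      exact ⟨by linarith [Real.pi_pos], by linarith⟩
    have hsq : z.sqrt = I.sqrt * exp (log (z / I) / 2) := by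
      rw [Complex.sqrt, Complex.sqrt, cpow_def_of_ne_zero (hne z hz), cpow_def_of_ne_zero I_ne_zero,
        ← exp_add, hlog]
      congr 1
      ring
    have hI : I.sqrt ≠ 0 := by
      rw [Complex.sqrt, cpow_def_of_ne_zero I_ne_zero]
      exact exp_ne_zero _
    have he := ModularForm.eta_ne_zero hz
    rw [hsq] at hs
    simp only [D]
    rw [exp_sub, exp_sub, exp_logEta hz, exp_logEta (im_neg_one_div_pos hz), hs]
    have := exp_ne_zero (log (z / I) / 2)
    field_simp
  have hderiv : Set.EqOn (deriv D) 0 {z : ℂ | 0 < z.im} := by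
    intro z hz
    have h1 : HasDerivAt (fun w => exp (D w)) (exp (D z) * deriv D z) z :=
      (hdiff z hz).hasDerivAt.cexp
    have h2 : (fun w => exp (D w)) =ᶠ[𝓝 z] fun _ => 1 := by
      filter_upwards [hopen.mem_nhds hz] with w hw using hexp w hw
    have h3 := h1.unique ((hasDerivAt_const z (1 : ℂ)).congr_of_eventuallyEq h2)
    simpa [hexp z hz] using h3
  have hconst := hopen.is_const_of_deriv_eq_zero (convex_halfSpace_im_gt 0).isPreconnected
    (fun z hz => (hdiff z hz).differentiableWithinAt) hderiv (x := τ) (y := I) hτ (by simp)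
  have hI : (-1 : ℂ) / I = I := by simp [div_I]
  simp only [D, hI, div_self I_ne_zero, log_one, sub_self, zero_div] at hconst
  linear_combination hconst

lemma log_mul_of_re_pos {x y : ℂ} (hx : 0 < x.re) (hy : 0 < y.re) :
    log (x * y) = log x + log y := by
  have h1 := abs_lt.mp (abs_arg_lt_pi_div_two_iff.mpr (Or.inl hx))
  have h2 := abs_lt.mp (abs_arg_lt_pi_div_two_iff.mpr (Or.inl hy))
  refine log_mul (fun h => by simp [h] at hx) (fun h => by simp [h] at hy) ⟨?_, ?_⟩ <;> linarith

lemma log_div_I_of_re_pos {z : ℂ} (hz : 0 < z.re) : log (z / I) = log z - π * I / 2 := by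
  have h1 := abs_lt.mp (abs_arg_lt_pi_div_two_iff.mpr (Or.inl hz))
  rw [div_I, ← mul_neg, log_mul (fun h => by simp [h] at hz) (neg_ne_zero.mpr I_ne_zero), log_neg_I]
  · ring
  · rw [arg_neg_I]
    constructor <;> linarith [Real.pi_pos]

lemma logEta_I_mul {z : ℂ} (hz : 0 < z.re) : logEta (I * z) = logEta (I / z) - log z / 2 := by
  have hz0 : z ≠ 0 := fun h => by simp [h] at hz
  have him : 0 < (I / z).im := by
    have : (I / z).im = z⁻¹.re := by simp [div_eq_mul_inv]
    rw [this, inv_re]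
    exact div_pos hz (normSq_pos.mpr hz0)
  have h := logEta_neg_one_div him
  have h1 : (-1 : ℂ) / (I / z) = I * z := by
    field_simp
    simp
  have h2 : I / z / I = z⁻¹ := by
    field_simp
  have h3 : log z⁻¹ = -log z := by
    refine log_inv z fun h => ?_
    have := abs_lt.mp (abs_arg_lt_pi_div_two_iff.mpr (Or.inl hz))
    linarith [Real.pi_pos]
  rw [h1, h2, h3] at h
  rw [h]
  ring

/-- The transformation of `log η` under a general modular substitution, `(h + i z) / k` being sent
to `(H + i / z) / k`. The proof runs the Euclidean algorithm on `(h, k)`: the inversion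
replaces `h / k` by `-k / h`, and the constants match by the reciprocity law. -/
theorem logEta_transform {k : ℕ} (hk : 0 < k) {h H : ℤ} (hH : h * H ≡ -1 [ZMOD k]) {z : ℂ}
    (hz : 0 < z.re) :
    logEta ((h + I * z) / k) = logEta ((H + I / z) / k) - log z / 2 - π * I * dedekindSum h k
      + π * I * (h - H) / (12 * k) := by
  induction k using Nat.strong_induction_on generalizing h H z with
  | _ k ih =>
  have hz0 : z ≠ 0 := fun h => by simp [h] at hz
  rcases Nat.lt_or_ge 1 k with hk1 | hk1
  swap
  · obtain rfl : k = 1 := by omega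
    have e1 : (h + I * z) / ((1 : ℕ) : ℂ) = I * z + h := by push_cast; ring
    have e2 : (H + I / z) / ((1 : ℕ) : ℂ) = I / z + H := by push_cast; ring
    rw [e1, e2, logEta_add_intCast, logEta_add_intCast, logEta_I_mul hz]
    simp [dedekindSum]
    ring
  have hkC : (k : ℂ) ≠ 0 := by exact_mod_cast hk.ne'
  -- Reduce `h` to its residue `h'`, which is positive because `k ≥ 2`.
  obtain ⟨h', hh'⟩ : ∃ h' : ℕ, (h' : ℤ) = h % k :=
    ⟨(h % k).toNat, Int.toNat_of_nonneg (Int.emod_nonneg _ (by omega))⟩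
  have hlt : h' < k := by
    have := Int.emod_lt_of_pos h (show (0 : ℤ) < k by omega)
    omega
  have hmodh : h ≡ h' [ZMOD k] := by rw [hh']; exact (Int.mod_modEq _ _).symm
  obtain ⟨m, hm⟩ := hmodh.symm.dvd
  have hm' : h = h' + k * m := by linarith
  obtain ⟨K, hK⟩ : (k : ℤ) ∣ h' * H - (-1) := ((hmodh.symm.mul_right H).trans hH).symm.dvd
  have hKeq : (h' : ℤ) * H = k * K - 1 := by linarith
  have hpos : 0 < h' := by
    rcases Nat.eq_zero_or_pos h' with h0 | h0
    · rw [h0] at hKeq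
      have : (k : ℤ) ∣ 1 := ⟨K, by push_cast at hKeq; linarith⟩
      have := Int.le_of_dvd one_pos this
      omega
    · exact h0
  have hcop : IsCoprime (k : ℤ) (h' : ℤ) := ⟨K, -H, by linarith⟩
  have hcopN : h'.Coprime k := (Nat.isCoprime_iff_coprime.mp hcop).symm
  have hKmod : (-(k : ℤ)) * K ≡ -1 [ZMOD h'] := by
    refine (Int.modEq_iff_dvd.mpr ⟨H, ?_⟩)
    linarith
  have hhC : (h' : ℂ) ≠ 0 := by exact_mod_cast hpos.ne'
  set τ : ℂ := (h' + I * z) / k with hτ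
  have hτim : 0 < τ.im := by
    have : τ.im = z.re / k := by
      rw [hτ, div_natCast_im]
      simp
    rw [this]
    positivity
  have hτ0 : τ ≠ 0 := fun h => by simp [h] at hτim
  have hnum : (h' : ℂ) + I * z ≠ 0 := fun h0 => hτ0 (by rw [hτ, h0, zero_div])
  set w : ℂ := k * z / (h' + I * z) with hw
  have hinv : (-1 : ℂ) / τ = (-k + I * w) / h' := by
    rw [hτ, hw]
    field_simp
    ring
  have hwre : 0 < w.re := by
    have h1 := im_neg_one_div_pos hτim
    rw [hinv, div_natCast_im] at h1
    have h2 : (-(k : ℂ) + I * w).im = w.re := by simp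
    rw [h2] at h1
    exact (div_pos_iff_of_pos_right (by positivity)).mp h1
  have hτre : 0 < (τ / I).re := by simpa [div_I] using hτim
  have hlog : log w + log (τ / I) = log z - π * I / 2 := by
    rw [← log_mul_of_re_pos hwre hτre, ← log_div_I_of_re_pos hz]
    congr 1
    have hnum' : (h' : ℂ) + z * I ≠ 0 := by rwa [mul_comm z I]
    rw [hw, hτ]
    field_simp
  have hS := logEta_neg_one_div hτim
  have hI := ih h' hlt hpos hKmod hwre
  have harg : (K + I / w) / (h' : ℂ) = (H + I / z) / k := by
    have hKC : (h' : ℂ) * H = k * K - 1 := by exact_mod_cast hKeq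
    rw [hw]
    field_simp
    linear_combination (-z) * hKC + z * I_sq
  have hcast : ((-(k : ℤ) : ℤ) : ℂ) = -(k : ℂ) := by push_cast; ring
  rw [hcast, ← hinv, harg, dedekindSum_neg hcop, hS] at hI
  have hrec := dedekindSum_reciprocity hpos hk hcopN
  have hrecC : (dedekindSum h' k : ℂ) + dedekindSum k h' =
      ((h' : ℂ) ^ 2 + (k : ℂ) ^ 2 + 1) / (12 * h' * k) - 1 / 4 := by
    have := congrArg (fun x : ℝ => (x : ℂ)) hrec
    push_cast at this
    exact this
  have e1 : ((h : ℂ) + I * z) / k = τ + m := by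
    rw [hτ, hm']
    push_cast
    field_simp
    ring
  have hconst : π * I * ((k : ℂ) + K) / (12 * h') =
      π * I * ((h' : ℂ) ^ 2 + (k : ℂ) ^ 2 + 1) / (12 * h' * k) - π * I * (h' - H) / (12 * k) := by
    have hKC : (h' : ℂ) * H = k * K - 1 := by exact_mod_cast hKeq
    field_simp
    linear_combination (-1 : ℂ) * hKC
  have hmC : (h : ℂ) = h' + k * m := by exact_mod_cast hm'
  have e2 : π * I * ((h : ℂ) - H) / (12 * k) = π * I * (h' - H) / (12 * k) + π * I * m / 12 := by
    rw [hmC]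
    field_simp
    ring
  rw [e1, logEta_add_intCast, dedekindSum_eq_of_modEq hk hmodh, e2]
  push_cast at hI hconst
  have e3 : π * I * (-(k : ℂ) - K) / (12 * h') = -(π * I * ((k : ℂ) + K) / (12 * h')) := by ring
  rw [e3, hconst] at hI
  linear_combination hI + (-1 / 2 : ℂ) * hlog + π * I * hrecC

/-! ### The dissection of a period into arcs of Ford circles -/

/-- A reduced residue system `h` modulo `k` is matched with the members prime to `k` of an interval
of length `k` by a congruence `h * b ≡ ε`, with `ε` a unit. -/
lemma sum_coprime_range_eq_sum_Ioc {k N : ℕ} (hkN : k ≤ N) {ε : ℤ} (hε : IsUnit ε)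
    {i j : ℕ → ℕ}
    (hi : ∀ h, h.Coprime k → i h ∈ Finset.Ioc (N - k) N ∧ (h : ℤ) * i h ≡ ε [ZMOD k])
    (hj : ∀ b, b.Coprime k → j b < k ∧ (b : ℤ) * j b ≡ ε [ZMOD k]) (φ : ℕ → ℕ → ℂ) :
    ∑ h ∈ (Finset.range k).filter (fun h => h.Coprime k), φ h (i h) =
      ∑ b ∈ (Finset.Ioc (N - k) N).filter (fun b => b.Coprime k), φ (j b) b := by
  have hcop : ∀ a b : ℕ, (a : ℤ) * b ≡ ε [ZMOD k] → b.Coprime k := by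
    intro a b hab
    obtain ⟨m, hm⟩ := hab.dvd
    rw [← Nat.isCoprime_iff_coprime]
    have h1 : IsCoprime ε (k : ℤ) := hε.elim fun u hu => ⟨(u⁻¹ : ℤˣ), 0, by simp [← hu]⟩
    have h2 : ε = a * b + k * m := by linarith
    rw [h2] at h1
    exact (IsCoprime.of_add_mul_left_left h1).of_mul_left_right
  have huniq : ∀ a x y : ℕ, a.Coprime k → (a : ℤ) * x ≡ ε [ZMOD k] → (a : ℤ) * y ≡ ε [ZMOD k] →
      (k : ℤ) ∣ y - x := by
    intro a x y ha hx hy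
    have h1 := (hx.trans hy.symm).dvd
    rw [← mul_sub] at h1
    exact (Nat.isCoprime_iff_coprime.mpr ha).symm.dvd_of_dvd_mul_left h1
  have hsmall : ∀ x : ℤ, (k : ℤ) ∣ x → -k < x → x < k → x = 0 := fun x hd h1 h2 =>
    Int.eq_zero_of_abs_lt_dvd hd (abs_lt.mpr ⟨h1, h2⟩)
  refine Finset.sum_bij' (fun h _ => i h) (fun b _ => j b) ?_ ?_ ?_ ?_ ?_
  · intro h hh
    obtain ⟨h1, h2⟩ := Finset.mem_filter.mp hh
    exact Finset.mem_filter.mpr ⟨(hi h h2).1, hcop _ _ (hi h h2).2⟩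
  · intro b hb
    obtain ⟨h1, h2⟩ := Finset.mem_filter.mp hb
    exact Finset.mem_filter.mpr ⟨Finset.mem_range.mpr (hj b h2).1, hcop _ _ (hj b h2).2⟩
  · intro h hh
    obtain ⟨h1, h2⟩ := Finset.mem_filter.mp hh
    have hc := hcop _ _ (hi h h2).2
    have h3 := huniq (i h) (j (i h)) h hc (hj _ hc).2 (by rw [mul_comm]; exact (hi h h2).2)
    have h4 := (hj _ hc).1
    rw [Finset.mem_range] at h1
    have := hsmall _ h3 (by omega) (by omega)
    omega
  · intro b hb
    obtain ⟨h1, h2⟩ := Finset.mem_filter.mp hb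
    have hc := hcop _ _ (hj b h2).2
    have h3 := huniq (j b) (i (j b)) b hc (hi _ hc).2 (by rw [mul_comm]; exact (hj b h2).2)
    have h4 := (hi _ hc).1
    rw [Finset.mem_Ioc] at h1 h4
    have := hsmall _ h3 (by omega) (by omega)
    omega
  · intro h hh
    obtain ⟨h1, h2⟩ := Finset.mem_filter.mp hh
    have hc := hcop _ _ (hi h h2).2
    have h3 := huniq (i h) (j (i h)) h hc (hj _ hc).2 (by rw [mul_comm]; exact (hi h h2).2)
    have h4 := (hj _ hc).1
    rw [Finset.mem_range] at h1
    have := hsmall _ h3 (by omega) (by omega)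
    congr 1
    omega

lemma negInv_lt (h : ℕ) {k : ℕ} (hk : 0 < k) : negInv h k < k := by
  have : NeZero k := ⟨hk.ne'⟩
  exact ZMod.val_lt _

/-- The point `h / k + i / (k (k + i t))`. As `t` runs through `ℝ` it describes the Ford circle
at `h / k`, of radius `1 / (2 k ^ 2)`, apart from the point of tangency with the real line. -/
noncomputable def fordPoint (h k : ℕ) (t : ℝ) : ℂ := (h : ℂ) / k + I / (k * (k + I * t))

lemma im_fordPoint (h : ℕ) {k : ℕ} (hk : 0 < k) (t : ℝ) : 0 < (fordPoint h k t).im := by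
  have h1 : (fordPoint h k t) = ((h + I * ((k : ℂ) + I * t)⁻¹)) / k := by
    rw [fordPoint]
    field_simp
  rw [h1, div_natCast_im]
  have h2 : ((h : ℂ) + I * ((k : ℂ) + I * t)⁻¹).im = (k : ℝ) / normSq ((k : ℂ) + I * t) := by
    simp [inv_re]
  rw [h2]
  have h3 : 0 < normSq ((k : ℂ) + I * t) := normSq_pos.mpr fun h0 => by
    have := congrArg re h0
    simp at this
    omega
  positivity

/-- The Ford circles at two neighbouring fractions `h / k < h' / b` touch: up to a translation,
which occurs only at the end of the period, the right end of an arc is the left end of the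
following one. -/
lemma fordPoint_right_eq_left {h k h' b : ℕ} (hk : 0 < k) (hb : 0 < b) (hc : b.Coprime k)
    (hh : h < k) (hh' : h' < b) (h1 : (b : ℤ) * h ≡ -1 [ZMOD k])
    (h2 : (k : ℤ) * h' ≡ 1 [ZMOD b]) :
    fordPoint h k b = fordPoint h' b (-k) + if b = 1 then 1 else 0 := by
  -- The left side is divisible by `k * b` and, unless `b = 1`, smaller than that in modulus.
  have key : (h : ℤ) * b - h' * k + 1 = if b = 1 then (k : ℤ) * b else 0 := by
    have d1 : (k : ℤ) ∣ h * b - h' * k + 1 := by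
      obtain ⟨m, hm⟩ := h1.symm.dvd
      exact ⟨m - h', by linarith⟩
    have d2 : (b : ℤ) ∣ h * b - h' * k + 1 := by
      obtain ⟨m, hm⟩ := h2.dvd
      exact ⟨m + h, by linarith⟩
    have d3 : (k : ℤ) * b ∣ h * b - h' * k + 1 :=
      (Nat.isCoprime_iff_coprime.mpr hc).symm.mul_dvd d1 d2
    split_ifs with hb1
    · subst hb1
      obtain rfl : h' = 0 := by omega
      have := Int.le_of_dvd (by push_cast; omega) d1
      push_cast at this ⊢
      omega
    · refine Int.eq_zero_of_abs_lt_dvd d3 (abs_lt.mpr ⟨?_, ?_⟩)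
      · have : (h' : ℤ) * k ≤ (b - 1) * k :=
          mul_le_mul_of_nonneg_right (by omega) (by positivity)
        have : (0 : ℤ) ≤ h * b := by positivity
        have : (0 : ℤ) < k := by omega
        linarith
      · have : (h : ℤ) * b ≤ (k - 1) * b :=
          mul_le_mul_of_nonneg_right (by omega) (by positivity)
        have : (0 : ℤ) ≤ h' * k := by positivity
        have : (1 : ℤ) < b := by omega
        linarith
  have hkC : (k : ℂ) ≠ 0 := by exact_mod_cast hk.ne'
  have hbC : (b : ℂ) ≠ 0 := by exact_mod_cast hb.ne'
  have hne : (k : ℂ) + I * b ≠ 0 := fun h0 => by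
    have := congrArg re h0
    simp at this
    omega
  have hrot : (b : ℂ) - I * k = -I * (k + I * b) := by
    linear_combination (b : ℂ) * I_sq
  have keyC : (h : ℂ) * b - h' * k + 1 = (if b = 1 then 1 else 0) * (k * b) := by
    have := congrArg (fun x : ℤ => (x : ℂ)) key
    push_cast at this
    rw [this]
    split_ifs <;> simp
  have e1 : fordPoint h k b - fordPoint h' b (-k) = ((h : ℂ) * b - h' * k + 1) / (k * b) := by
    rw [fordPoint, fordPoint]
    push_cast
    rw [mul_neg, ← sub_eq_add_neg, hrot]
    field_simp
    ring
  rw [← sub_eq_iff_eq_add', e1, keyC, mul_div_assoc, div_self (mul_ne_zero hkC hbC), mul_one]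

/-- The Ford circles at the fractions with denominators at most `N` cut out a path which joins a
point to its translate by `1`: for each fraction `h / k` the arc from `t = -l` to `t = r`, with
`l` and `r` the denominators of the neighbouring fractions. The path is encoded by what is used of
it: the increments along its arcs of a function `P` that is periodic up to a constant add up to
that constant. -/
theorem exists_ford_dissection {N : ℕ} (hN : 0 < N) :
    ∃ l r : ℕ → ℕ → ℕ,
      (∀ k ∈ Finset.Icc 1 N, ∀ h : ℕ, l h k ∈ Finset.Ioc (N - k) N ∧ r h k ∈ Finset.Ioc (N - k) N) ∧
      ∀ (P : ℂ → ℂ) (c : ℂ), (∀ τ : ℂ, 0 < τ.im → P (τ + 1) = P τ + c) →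
        ∑ k ∈ Finset.Icc 1 N, ∑ h ∈ (Finset.range k).filter (fun h => h.Coprime k),
          (P (fordPoint h k (r h k)) - P (fordPoint h k (-(l h k : ℝ)))) = c := by
  -- With `H = negInv h k`, the neighbours' denominators are the members of the residue classes of
  -- `-H` (on the left) and `H` (on the right) modulo `k` in the interval `(N - k, N]`.
  let l : ℕ → ℕ → ℕ := fun h k => N - (N + negInv h k) % k
  let r : ℕ → ℕ → ℕ := fun h k => N - (N - negInv h k) % k
  let inv : ℕ → ℕ → ℕ := fun b k => (k - negInv b k) % k
  have hlr : ∀ k ∈ Finset.Icc 1 N, ∀ h : ℕ,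
      l h k ∈ Finset.Ioc (N - k) N ∧ r h k ∈ Finset.Ioc (N - k) N := by
    intro k hk h
    rw [Finset.mem_Icc] at hk
    have h1 := Nat.mod_lt (N + negInv h k) hk.1
    have h2 := Nat.mod_lt (N - negInv h k) hk.1
    simp only [l, r, Finset.mem_Ioc]
    omega
  refine ⟨l, r, hlr, fun P c hP => ?_⟩
  have hl : ∀ k ∈ Finset.Icc 1 N, ∀ h : ℕ, h.Coprime k → (h : ℤ) * l h k ≡ 1 [ZMOD k] := by
    intro k hk h hc
    rw [Finset.mem_Icc] at hk
    have h1 := mul_negInv_modEq h k (by omega) hc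
    have h2 : (l h k : ℤ) ≡ -negInv h k [ZMOD k] := by
      have h3 := Nat.mod_lt (N + negInv h k) hk.1
      have h4 : (l h k : ℤ) = N - ((N + negInv h k : ℕ) : ℤ) % k := by
        simp only [l]
        rw [Nat.cast_sub (by omega)]
        push_cast
        ring
      rw [h4]
      have h5 : (N : ℤ) - ((N + negInv h k : ℕ) : ℤ) % k ≡ N - ((N + negInv h k : ℕ) : ℤ) [ZMOD k] :=
        (Int.ModEq.refl _).sub (Int.mod_modEq _ _)
      refine h5.trans ?_
      push_cast
      rw [sub_add_cancel_left]
    calc (h : ℤ) * l h k ≡ h * -negInv h k [ZMOD k] := h2.mul_left _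
      _ = -(h * negInv h k) := by ring
      _ ≡ -(-1) [ZMOD k] := h1.neg
      _ = 1 := by norm_num
  have hr : ∀ k ∈ Finset.Icc 1 N, ∀ h : ℕ, h.Coprime k → (h : ℤ) * r h k ≡ -1 [ZMOD k] := by
    intro k hk h hc
    rw [Finset.mem_Icc] at hk
    have h1 := mul_negInv_modEq h k (by omega) hc
    have h0 := negInv_lt h hk.1
    have h2 : (r h k : ℤ) ≡ negInv h k [ZMOD k] := by
      have h3 := Nat.mod_lt (N - negInv h k) hk.1
      have h4 : (r h k : ℤ) = N - ((N - negInv h k : ℕ) : ℤ) % k := by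
        simp only [r]
        rw [Nat.cast_sub (by omega)]
        push_cast
        ring
      rw [h4]
      have h5 : (N : ℤ) - ((N - negInv h k : ℕ) : ℤ) % k ≡ N - ((N - negInv h k : ℕ) : ℤ) [ZMOD k] :=
        (Int.ModEq.refl _).sub (Int.mod_modEq _ _)
      refine h5.trans ?_
      rw [Nat.cast_sub (by omega), sub_sub_cancel]
    exact (h2.mul_left _).trans h1
  have hinv : ∀ k : ℕ, 0 < k → ∀ b : ℕ, b.Coprime k →
      inv b k < k ∧ (b : ℤ) * inv b k ≡ 1 [ZMOD k] := by
    intro k hk b hc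
    refine ⟨Nat.mod_lt _ hk, ?_⟩
    have h1 := mul_negInv_modEq b k (by omega) hc
    have h0 := negInv_lt b hk
    have h2 : (inv b k : ℤ) ≡ k - negInv b k [ZMOD k] := by
      simp only [inv]
      push_cast [Nat.cast_sub h0.le]
      exact Int.mod_modEq _ _
    have h3 : (k : ℤ) - negInv b k ≡ 0 - negInv b k [ZMOD k] :=
      Int.ModEq.sub (by simp [Int.ModEq]) (Int.ModEq.refl _)
    calc (b : ℤ) * inv b k ≡ b * (0 - negInv b k) [ZMOD k] := (h2.trans h3).mul_left _
      _ = -(b * negInv b k) := by ring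
      _ ≡ -(-1) [ZMOD k] := h1.neg
      _ = 1 := by norm_num
  -- Both ends of the arcs are indexed by the pairs of neighbouring denominators, so that the right
  -- ends cancel against the left ends except for the pair `(N, 1)` at the end of the period.
  have hR : ∑ k ∈ Finset.Icc 1 N, ∑ h ∈ (Finset.range k).filter (fun h => h.Coprime k),
      P (fordPoint h k (r h k)) = ∑ k ∈ Finset.Icc 1 N,
        ∑ b ∈ (Finset.Ioc (N - k) N).filter (fun b => b.Coprime k),
          P (fordPoint (negInv b k) k b) := by
    refine Finset.sum_congr rfl fun k hk => ?_
    have hk' := Finset.mem_Icc.mp hk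
    exact sum_coprime_range_eq_sum_Ioc hk'.2 (ε := -1) (by simp)
      (i := fun h => r h k) (j := fun b => negInv b k)
      (fun h hc => ⟨(hlr k hk h).2, hr k hk h hc⟩)
      (fun b hc => ⟨negInv_lt b hk'.1, mul_negInv_modEq b k (by omega) hc⟩)
      (fun h b => P (fordPoint h k b))
  have hL : ∑ k ∈ Finset.Icc 1 N, ∑ h ∈ (Finset.range k).filter (fun h => h.Coprime k),
      P (fordPoint h k (-(l h k : ℝ))) = ∑ k ∈ Finset.Icc 1 N,
        ∑ b ∈ (Finset.Ioc (N - k) N).filter (fun b => b.Coprime k),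
          P (fordPoint (inv k b) b (-(k : ℝ))) := by
    have h1 : ∑ k ∈ Finset.Icc 1 N, ∑ h ∈ (Finset.range k).filter (fun h => h.Coprime k),
        P (fordPoint h k (-(l h k : ℝ))) = ∑ b ∈ Finset.Icc 1 N,
          ∑ k ∈ (Finset.Ioc (N - b) N).filter (fun k => k.Coprime b),
            P (fordPoint (inv k b) b (-(k : ℝ))) := by
      refine Finset.sum_congr rfl fun k hk => ?_
      have hk' := Finset.mem_Icc.mp hk
      exact sum_coprime_range_eq_sum_Ioc hk'.2 (ε := 1) (by simp)
        (i := fun h => l h k) (j := fun b => inv b k)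
        (fun h hc => ⟨(hlr k hk h).1, hl k hk h hc⟩) (fun b hc => hinv k hk'.1 b hc)
        (fun h b => P (fordPoint h k (-(b : ℝ))))
    rw [h1]
    refine Finset.sum_comm' fun b k => ?_
    simp only [Finset.mem_Icc, Finset.mem_filter, Finset.mem_Ioc, Nat.coprime_comm (m := k)]
    constructor <;> rintro ⟨h1, h2⟩ <;> refine ⟨⟨?_, ?_⟩, ?_⟩ <;> omega
  simp only [Finset.sum_sub_distrib]
  rw [hR, hL, ← Finset.sum_sub_distrib]
  simp only [← Finset.sum_sub_distrib]
  have hterm : ∀ k ∈ Finset.Icc 1 N, ∀ b ∈ (Finset.Ioc (N - k) N).filter (fun b => b.Coprime k),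
      P (fordPoint (negInv b k) k b) - P (fordPoint (inv k b) b (-(k : ℝ))) =
        if b = 1 then (if k = N then c else 0) else 0 := by
    intro k hk b hb
    obtain ⟨hb1, hc⟩ := Finset.mem_filter.mp hb
    rw [Finset.mem_Ioc] at hb1
    rw [Finset.mem_Icc] at hk
    have hi := hinv b (by omega) k hc.symm
    rw [fordPoint_right_eq_left hk.1 (by omega) hc (negInv_lt b hk.1) hi.1
      (mul_negInv_modEq b k (by omega) hc) hi.2]
    split_ifs with h1 h2
    · rw [hP _ (im_fordPoint _ (by omega) _)]
      ring
    · omega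
    · simp
  rw [Finset.sum_congr rfl fun k hk => Finset.sum_congr rfl (hterm k hk)]
  rw [Finset.sum_eq_single N, Finset.sum_eq_single 1]
  · simp
  · intro b _ hb
    simp [hb]
  · intro h1
    exact absurd (Finset.mem_filter.mpr ⟨Finset.mem_Ioc.mpr (by omega), by simp⟩) h1
  · intro k _ hk
    simp [hk]
  · intro h1
    exact absurd (Finset.mem_Icc.mpr ⟨by omega, le_rfl⟩) h1

/-! ### The Bessel function as an inverse Laplace integral -/

lemma add_I_mul_mem_slitPlane {σ : ℝ} (hσ : 0 < σ) (t : ℝ) : (σ : ℂ) + I * t ∈ slitPlane := by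
  rw [mem_slitPlane_iff]
  left
  simpa using hσ

lemma add_I_mul_ne_zero {σ : ℝ} (hσ : 0 < σ) (t : ℝ) : (σ : ℂ) + I * t ≠ 0 :=
  slitPlane_ne_zero (add_I_mul_mem_slitPlane hσ t)

lemma sq_norm_add_I_mul (σ t : ℝ) : ‖(σ : ℂ) + I * t‖ ^ 2 = σ ^ 2 + t ^ 2 := by
  rw [← normSq_eq_norm_sq, normSq_apply]
  simp
  ring

lemma le_norm_add_I_mul (σ t : ℝ) : σ ≤ ‖(σ : ℂ) + I * t‖ := by
  have h := re_le_norm ((σ : ℂ) + I * t)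
  simpa using h

/-- The Laplace transform of `t ^ (γ - 1)` on the open right half-plane, by continuation from the
positive axis. -/
theorem laplace_rpow {γ : ℝ} (hγ : 0 < γ) {s : ℂ} (hs : 0 < s.re) :
    ∫ t in Set.Ioi (0 : ℝ), ((t ^ (γ - 1) : ℝ) : ℂ) * exp (-(s * t)) =
      Real.Gamma γ * s ^ ((-γ : ℝ) : ℂ) := by
  let F : ℂ → ℂ := fun s => ∫ t in Set.Ioi (0 : ℝ), ((t ^ (γ - 1) : ℝ) : ℂ) * exp (-(s * t))
  let U : Set ℂ := {s | 0 < s.re}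
  have hU : IsOpen U := isOpen_lt continuous_const continuous_re
  have hint : ∀ a b : ℝ, -1 < a → 0 < b →
      IntegrableOn (fun t : ℝ => t ^ a * Real.exp (-b * t)) (Set.Ioi 0) := by
    intro a b ha hb
    simpa using integrableOn_rpow_mul_exp_neg_mul_rpow ha one_pos hb
  have hmeas : ∀ (a : ℝ) (s : ℂ), AEStronglyMeasurable
      (fun t : ℝ => ((t ^ a : ℝ) : ℂ) * exp (-(s * t))) (volume.restrict (Set.Ioi 0)) := by
    intro a s
    refine ContinuousOn.aestronglyMeasurable (fun t ht => ContinuousAt.continuousWithinAt ?_)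
      measurableSet_Ioi
    have : ContinuousAt (fun t : ℝ => ((t ^ a : ℝ) : ℂ)) t :=
      continuous_ofReal.continuousAt.comp (Real.continuousAt_rpow_const _ _ (Or.inl ht.ne'))
    exact this.mul (by fun_prop)
  have hnorm : ∀ (a : ℝ) (s : ℂ) (t : ℝ), 0 < t →
      ‖((t ^ a : ℝ) : ℂ) * exp (-(s * t))‖ = t ^ a * Real.exp (-s.re * t) := by
    intro a s t ht
    rw [norm_mul, norm_real, Real.norm_of_nonneg (Real.rpow_nonneg ht.le _), norm_exp]
    simp
  have hF : DifferentiableOn ℂ F U := by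
    intro s₀ hs₀
    have hs₀' : 0 < s₀.re := hs₀
    have hnhds : {s : ℂ | s₀.re / 2 < s.re} ∈ 𝓝 s₀ :=
      (isOpen_lt continuous_const continuous_re).mem_nhds (show s₀.re / 2 < s₀.re by linarith)
    have h := hasDerivAt_integral_of_dominated_loc_of_deriv_le
      (μ := volume.restrict (Set.Ioi (0 : ℝ)))
      (F := fun (s : ℂ) (t : ℝ) => ((t ^ (γ - 1) : ℝ) : ℂ) * exp (-(s * t)))
      (F' := fun (s : ℂ) (t : ℝ) => ((t ^ (γ - 1) : ℝ) : ℂ) * (exp (-(s * t)) * (-t)))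
      (bound := fun t : ℝ => t ^ γ * Real.exp (-(s₀.re / 2) * t)) (x₀ := s₀) hnhds
      (Eventually.of_forall fun s => hmeas _ s) ?_ ?_ ?_ (hint _ _ (by linarith) (by linarith)) ?_
    · exact h.2.differentiableAt.differentiableWithinAt
    · refine (hint (γ - 1) s₀.re (by linarith) hs₀').mono' (hmeas _ _) ?_
      filter_upwards [self_mem_ae_restrict measurableSet_Ioi] with t ht
      exact (hnorm _ _ _ ht).le
    · have hm : AEStronglyMeasurable (fun t : ℝ => (-t : ℂ)) (volume.restrict (Set.Ioi 0)) :=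
        Continuous.aestronglyMeasurable (by fun_prop)
      refine ((hmeas (γ - 1) s₀).mul hm).congr ?_
      filter_upwards with t
      simp only [Pi.mul_apply]
      ring
    · filter_upwards [self_mem_ae_restrict measurableSet_Ioi] with t ht s hs
      have ht' : (0 : ℝ) < t := ht
      have hs' : s₀.re / 2 < s.re := hs
      rw [← mul_assoc, norm_mul, hnorm _ _ _ ht', norm_neg, norm_real, Real.norm_of_nonneg ht'.le]
      have e : t ^ γ = t ^ (γ - 1) * t := by
        rw [← Real.rpow_add_one ht'.ne', sub_add_cancel]
      rw [e, mul_right_comm]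
      gcongr
    · filter_upwards with t s _
      have h1 : HasDerivAt (fun s : ℂ => -(s * t)) (-(t : ℂ)) s := by
        simpa using! ((hasDerivAt_id s).mul_const (t : ℂ)).neg
      exact h1.cexp.const_mul _
  have hG : DifferentiableOn ℂ (fun s : ℂ => Real.Gamma γ * s ^ ((-γ : ℝ) : ℂ)) U := by
    intro s hs
    refine (DifferentiableAt.const_mul (DifferentiableAt.cpow_const differentiableAt_id ?_)
      _).differentiableWithinAt
    exact mem_slitPlane_iff.mpr (Or.inl hs)
  have hreal : ∀ r : ℝ, 0 < r → F r = Real.Gamma γ * (r : ℂ) ^ ((-γ : ℝ) : ℂ) := by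
    intro r hr
    have h := Real.integral_rpow_mul_exp_neg_mul_Ioi hγ hr
    have h1 : F r = ((∫ t in Set.Ioi (0 : ℝ), t ^ (γ - 1) * Real.exp (-(r * t)) : ℝ) : ℂ) := by
      rw [← integral_complex_ofReal]
      refine integral_congr_ae (Eventually.of_forall fun t => ?_)
      push_cast
      rfl
    rw [h1, h, one_div, Real.inv_rpow hr.le, ← Real.rpow_neg hr.le, mul_comm]
    push_cast [ofReal_cpow hr.le]
    rfl
  have hfreq : ∃ᶠ z in 𝓝[≠] (1 : ℂ), F z = Real.Gamma γ * z ^ ((-γ : ℝ) : ℂ) := by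
    have h1 : Tendsto (fun n : ℕ => (((1 + 1 / ((n : ℝ) + 1) : ℝ)) : ℂ)) atTop (𝓝[≠] (1 : ℂ)) := by
      refine tendsto_nhdsWithin_iff.mpr ⟨?_, Eventually.of_forall fun n => ?_⟩
      · have := (tendsto_one_div_add_atTop_nhds_zero_nat (𝕜 := ℝ)).const_add 1
        rw [add_zero] at this
        exact (continuous_ofReal.tendsto 1).comp this
      · have : (0 : ℝ) < 1 / ((n : ℝ) + 1) := by positivity
        intro h
        have h2 := congrArg re h
        rw [ofReal_re, one_re] at h2
        linarith
    exact h1.frequently (Frequently.of_forall fun n => hreal _ (by positivity))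
  exact AnalyticOnNhd.eqOn_of_preconnected_of_frequently_eq (hF.analyticOnNhd hU)
    (hG.analyticOnNhd hU) (convex_halfSpace_re_gt 0).isPreconnected (z₀ := 1)
    (by simp [U]) hfreq hs

lemma integrable_norm_add_I_mul_rpow {σ γ : ℝ} (hσ : 1 ≤ σ) (hγ : 1 < γ) :
    Integrable fun t : ℝ => ‖(σ : ℂ) + I * t‖ ^ (-γ) := by
  have h := integrable_rpow_neg_one_add_norm_sq (E := ℝ) (μ := volume) (r := γ) (by simpa using hγ)
  have hpos : ∀ t : ℝ, 0 < ‖(σ : ℂ) + I * t‖ := fun t =>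
    norm_pos_iff.mpr (add_I_mul_ne_zero (by linarith) t)
  refine h.mono' ?_ (Eventually.of_forall fun t => ?_)
  · refine Continuous.aestronglyMeasurable ?_
    exact Continuous.rpow_const (by fun_prop) fun t => Or.inl (hpos t).ne'
  · rw [Real.norm_of_nonneg (Real.rpow_nonneg (norm_nonneg _) _)]
    have e : ‖(σ : ℂ) + I * t‖ ^ (-γ) = (σ ^ 2 + t ^ 2) ^ (-γ / 2) := by
      rw [← sq_norm_add_I_mul, ← Real.rpow_natCast, ← Real.rpow_mul (norm_nonneg _)]
      congr 1
      push_cast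
      ring
    rw [e, Real.norm_eq_abs, sq_abs]
    refine Real.rpow_le_rpow_of_nonpos (by positivity) ?_ (by linarith)
    nlinarith

lemma continuous_add_I_mul_cpow {σ : ℝ} (hσ : 0 < σ) (γ : ℝ) :
    Continuous fun t : ℝ => ((σ : ℂ) + I * t) ^ ((γ : ℝ) : ℂ) :=
  Continuous.cpow (by fun_prop) continuous_const fun t => add_I_mul_mem_slitPlane hσ t

/-- The inverse Laplace transform of `u ^ (-γ)`: Fourier inversion for the function
`x ^ (γ - 1) * exp (-σ x)` on the positive axis, extended by zero. -/
theorem integral_add_I_mul_cpow_mul_exp {σ γ c : ℝ} (hσ : 1 ≤ σ) (hγ : 1 < γ) (hc : 0 ≤ c) :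
    ∫ t : ℝ, ((σ : ℂ) + I * t) ^ ((-γ : ℝ) : ℂ) * exp (c * (σ + I * t)) =
      ((2 * π * c ^ (γ - 1) / Real.Gamma γ : ℝ) : ℂ) := by
  have hσ0 : 0 < σ := by linarith
  have hΓ : Real.Gamma γ ≠ 0 := (Real.Gamma_pos_of_pos (by linarith)).ne'
  let f : ℝ → ℂ := fun x => ((max x 0 ^ (γ - 1) * Real.exp (-σ * max x 0) : ℝ) : ℂ)
  have hzero : ∀ x : ℝ, x ≤ 0 → f x = 0 := by
    intro x hx
    simp [f, max_eq_right hx, Real.zero_rpow (by linarith : γ - 1 ≠ 0)]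
  have hf : f = Set.indicator (Set.Ioi 0)
      (fun x : ℝ => ((x ^ (γ - 1) * Real.exp (-σ * x) : ℝ) : ℂ)) := by
    ext x
    rcases lt_or_ge 0 x with hx | hx
    · rw [Set.indicator_of_mem (show x ∈ Set.Ioi 0 from hx)]
      simp only [f, max_eq_left hx.le]
    · rw [Set.indicator_of_notMem (show x ∉ Set.Ioi 0 from not_lt.mpr hx), hzero x hx]
  have hcont : Continuous f := by
    refine continuous_ofReal.comp (Continuous.mul ?_ (by fun_prop))
    exact Continuous.rpow_const (by fun_prop) fun x => Or.inr (by linarith)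
  have hfi : Integrable f := by
    rw [hf, integrable_indicator_iff measurableSet_Ioi]
    have h := integrableOn_rpow_mul_exp_neg_mul_rpow (s := γ - 1) (by linarith) one_pos hσ0
    simp only [Real.rpow_one] at h
    exact Integrable.ofReal h
  have hFf : 𝓕 f = fun ξ : ℝ => Real.Gamma γ *
      ((σ : ℂ) + I * ((2 * π * ξ : ℝ) : ℂ)) ^ ((-γ : ℝ) : ℂ) := by
    ext ξ
    rw [← laplace_rpow (by linarith) (by simpa using hσ0), Real.fourier_real_eq_integral_exp_smul,
      ← integral_indicator measurableSet_Ioi]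
    refine integral_congr_ae (Eventually.of_forall fun x => ?_)
    simp only [hf, Set.indicator_apply, smul_eq_mul]
    split_ifs
    · push_cast
      rw [mul_left_comm, ← exp_add]
      congr 2
      ring
    · simp
  have hFi : Integrable (𝓕 f) := by
    rw [hFf]
    refine Integrable.const_mul ?_ _
    have h1 : Integrable fun t : ℝ => ((σ : ℂ) + I * t) ^ ((-γ : ℝ) : ℂ) := by
      refine (integrable_norm_add_I_mul_rpow hσ hγ).mono'
        (continuous_add_I_mul_cpow hσ0 _).aestronglyMeasurable
        (Eventually.of_forall fun t => ?_)
      rw [norm_cpow_real]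
    exact h1.comp_mul_left' (R := 2 * π) (by positivity)
  have hinv := hfi.fourierInv_fourier_eq hFi (v := c) hcont.continuousAt
  rw [Real.fourierInv_eq', hFf] at hinv
  have h2 := Measure.integral_comp_mul_left
    (fun t : ℝ => ((σ : ℂ) + I * t) ^ ((-γ : ℝ) : ℂ) * exp (c * (σ + I * t))) (2 * π)
  have h3 : ∫ ξ : ℝ, ((σ : ℂ) + I * ((2 * π * ξ : ℝ) : ℂ)) ^ ((-γ : ℝ) : ℂ) *
      exp (c * (σ + I * ((2 * π * ξ : ℝ) : ℂ))) = exp (c * σ) / Real.Gamma γ * f c := by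
    rw [← hinv, ← integral_const_mul]
    refine integral_congr_ae (Eventually.of_forall fun ξ => ?_)
    have hΓ' : (Real.Gamma γ : ℂ) ≠ 0 := by exact_mod_cast hΓ
    simp only [smul_eq_mul]
    have e : exp ((c : ℂ) * (σ + I * ((2 * π * ξ : ℝ) : ℂ))) =
        exp (c * σ) * exp (((2 * π * inner ℝ ξ c : ℝ) : ℂ) * I) := by
      rw [← exp_add]
      congr 1
      simp only [RCLike.inner_apply, conj_trivial]
      push_cast
      ring
    rw [e]
    field_simp
  rw [h3, abs_of_pos (by positivity), eq_comm, inv_smul_eq_iff₀ (by positivity)] at h2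
  rw [h2]
  simp only [f, max_eq_left hc]
  have he : exp ((c : ℂ) * σ) = ((Real.exp (c * σ) : ℝ) : ℂ) := by push_cast; rfl
  rw [he, real_smul]
  norm_cast
  have : Real.exp (-σ * c) = (Real.exp (c * σ))⁻¹ := by rw [← Real.exp_neg]; ring_nf
  rw [this]
  have hne := (Real.exp_pos (c * σ)).ne'
  field_simp

lemma integrable_add_I_mul_cpow_mul_exp {σ γ c : ℝ} (hσ : 1 ≤ σ) (hγ : 1 < γ) :
    Integrable fun t : ℝ => ((σ : ℂ) + I * t) ^ ((-γ : ℝ) : ℂ) * exp (c * (σ + I * t)) := by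
  refine ((integrable_norm_add_I_mul_rpow hσ hγ).mul_const (Real.exp (c * σ))).mono'
    ((continuous_add_I_mul_cpow (by linarith) _).mul (by fun_prop)).aestronglyMeasurable
    (Eventually.of_forall fun t => ?_)
  rw [norm_mul, norm_cpow_real, norm_exp]
  simp

/-- Expansion in powers of `b` of the integral that yields the Bessel function: the exponential
series of `exp (b / u)` is integrated term by term. -/
theorem hasSum_integral_cpow_mul_exp_add_div {σ β b c : ℝ} (hσ : 1 ≤ σ) (hβ : 0 < β) (hb : 0 ≤ b)
    (hc : 0 ≤ c) :
    HasSum (fun j : ℕ => ((2 * π * c ^ β * ((b * c) ^ j / (j.factorial * Real.Gamma (β + j + 1))) :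
        ℝ) : ℂ))
      (∫ t : ℝ, ((σ : ℂ) + I * t) ^ ((-(β + 1) : ℝ) : ℂ) *
        exp (c * (σ + I * t) + b / (σ + I * t))) := by
  have hσ0 : 0 < σ := by linarith
  let F : ℕ → ℝ → ℂ := fun j t => ((b ^ j / j.factorial : ℝ) : ℂ) *
    (((σ : ℂ) + I * t) ^ ((-(β + j + 1) : ℝ) : ℂ) * exp (c * (σ + I * t)))
  have hFi : ∀ j, Integrable (F j) := fun j =>
    (integrable_add_I_mul_cpow_mul_exp hσ
      (by have : (0 : ℝ) ≤ j := j.cast_nonneg; linarith)).const_mul _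
  have hG := integrable_norm_add_I_mul_rpow (γ := β + 1) hσ (by linarith)
  have hFn : ∀ j t, ‖F j t‖ ≤
      b ^ j / j.factorial * (‖(σ : ℂ) + I * t‖ ^ (-(β + 1)) * Real.exp (c * σ)) := by
    intro j t
    have h1 : 1 ≤ ‖(σ : ℂ) + I * t‖ := hσ.trans (le_norm_add_I_mul σ t)
    have h2 : (0 : ℝ) ≤ j := j.cast_nonneg
    have h3 : ‖exp ((c : ℂ) * (σ + I * t))‖ = Real.exp (c * σ) := by
      rw [norm_exp]
      simp
    simp only [F]
    rw [norm_mul, norm_mul, norm_cpow_real, h3, norm_real, Real.norm_of_nonneg (by positivity)]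
    gcongr ?_ * (?_ * _)
    exact Real.rpow_le_rpow_of_exponent_le h1 (by linarith)
  have hsum : Summable fun j => ∫ t, ‖F j t‖ := by
    refine Summable.of_nonneg_of_le (fun j => integral_nonneg fun t => norm_nonneg _)
      (fun j => integral_mono (hFi j).norm ((hG.mul_const _).const_mul _) (hFn j)) ?_
    simp only [integral_const_mul]
    exact (Real.summable_pow_div_factorial b).mul_right _
  have h := hasSum_integral_of_summable_integral_norm hFi hsum
  have hpt : ∀ t : ℝ, ∑' j, F j t = ((σ : ℂ) + I * t) ^ ((-(β + 1) : ℝ) : ℂ) *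
      exp (c * (σ + I * t) + b / (σ + I * t)) := by
    intro t
    have hu := add_I_mul_ne_zero hσ0 t
    have h1 : ∀ j, F j t = ((σ : ℂ) + I * t) ^ ((-(β + 1) : ℝ) : ℂ) * exp (c * (σ + I * t)) *
        ((b / (σ + I * t)) ^ j / j.factorial) := by
      intro j
      have e : ((-(β + j + 1) : ℝ) : ℂ) = ((-(β + 1) : ℝ) : ℂ) - (j : ℂ) := by
        push_cast
        ring
      simp only [F]
      rw [e, cpow_sub _ _ hu, cpow_natCast, div_pow]
      push_cast
      ring
    simp only [h1]
    rw [tsum_mul_left, exp_add, exp_eq_exp_ℂ, NormedSpace.exp_eq_tsum_div (𝔸 := ℂ), mul_assoc]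
  have hj : ∀ j, ∫ t, F j t =
      ((2 * π * c ^ β * ((b * c) ^ j / (j.factorial * Real.Gamma (β + j + 1))) : ℝ) : ℂ) := by
    intro j
    have h2 : (0 : ℝ) ≤ j := j.cast_nonneg
    simp only [F]
    rw [integral_const_mul, integral_add_I_mul_cpow_mul_exp hσ (by linarith) hc, add_sub_cancel_right,
      Real.rpow_add_of_nonneg hc hβ.le h2, Real.rpow_natCast, ← ofReal_mul]
    congr 1
    rw [mul_pow]
    have : (j.factorial : ℝ) ≠ 0 := by positivity
    have hΓ : Real.Gamma (β + j + 1) ≠ 0 := (Real.Gamma_pos_of_pos (by linarith)).ne'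
    field_simp
  simp only [hpt, hj] at h
  exact h

lemma summable_besselI_series {ν : ℝ} (hν : 0 < ν) (x : ℝ) :
    Summable fun j : ℕ => (x / 2) ^ (2 * j) / ((j.factorial : ℝ) * Real.Gamma (ν + (j : ℝ) + 1)) := by
  have h := (hasSum_integral_cpow_mul_exp_add_div (b := (x / 2) ^ 2) (c := 1) le_rfl hν (by positivity)
    zero_le_one).summable
  have h1 := (summable_ofReal.mp h).mul_left (2 * π)⁻¹
  refine h1.congr fun j => ?_
  have := Real.pi_pos.ne'
  rw [Real.one_rpow, mul_one, mul_one, pow_mul]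
  field_simp

/-- Integration along the vertical line through `k` produces the Bessel function. -/
theorem integral_eq_besselI {β ν μ : ℝ} {k : ℕ} (hk : 0 < k) (hβ : 0 < β) (hν : 0 < ν)
    (hμ : 0 ≤ μ) :
    ∫ t : ℝ, ((k : ℂ) + I * t) ^ ((-(β + 1) : ℝ) : ℂ) *
        exp (((2 * π * μ ^ 2 / k : ℝ) : ℂ) * (k + I * t) + ((2 * π * ν ^ 2 / k : ℝ) : ℂ) / (k + I * t)) =
      ((2 * π * (μ / ν) ^ β * besselI β (4 * π / k * ν * μ) : ℝ) : ℂ) := by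
  have hk1 : (1 : ℝ) ≤ k := by exact_mod_cast hk
  have h := (hasSum_integral_cpow_mul_exp_add_div (b := 2 * π * ν ^ 2 / k) (c := 2 * π * μ ^ 2 / k) hk1 hβ
    (by positivity) (by positivity)).tsum_eq
  rw [ofReal_natCast] at h
  rw [← h, ← ofReal_tsum, tsum_mul_left, besselI]
  congr 1
  have e1 : (μ / ν) ^ β * (4 * π / k * ν * μ / 2) ^ β = (2 * π * μ ^ 2 / k) ^ β := by
    rw [← Real.mul_rpow (by positivity) (by positivity)]
    congr 1
    field_simp
    ring
  have e2 : ∀ j : ℕ, (4 * π / k * ν * μ / 2) ^ (2 * j) =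
      (2 * π * ν ^ 2 / k * (2 * π * μ ^ 2 / k)) ^ j := by
    intro j
    rw [pow_mul]
    congr 1
    ring
  simp only [e2]
  rw [← e1]
  ring

/-! ### The integrand on a Ford circle -/

/-- The generating function of `p α` in the variable `τ`, as the `-α`-th power of the Euler
product. -/
noncomputable def genSeries (α : ℝ) (τ : ℂ) : ℂ := exp (-α * logEuler τ)

lemma hasSum_genSeries {α : ℝ} (hα : 0 ≤ α) {τ : ℂ} (hτ : 0 < τ.im) :
    HasSum (fun m : ℕ => (p α m : ℂ) * exp (2 * π * I * τ) ^ m) (genSeries α τ) :=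
  hasSum_p_mul_pow hα (norm_exp_two_pi_I_mul_lt_one hτ)

lemma differentiableAt_genSeries (α : ℝ) {τ : ℂ} (hτ : 0 < τ.im) :
    DifferentiableAt ℂ (genSeries α) τ :=
  ((differentiableAt_logEuler hτ).const_mul _).cexp

/-- A primitive of `genSeries α τ * exp (-2 π i n τ)`, obtained by integrating the `q`-expansion
term by term. It is periodic up to the contribution of the constant term, which is `p α n`. -/
theorem exists_primitive {α : ℝ} (hα : 0 ≤ α) (n : ℕ) :
    ∃ P : ℂ → ℂ,
      (∀ τ : ℂ, 0 < τ.im → HasDerivAt P (genSeries α τ * exp (-(2 * π * I * n * τ))) τ) ∧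
      ∀ τ : ℂ, 0 < τ.im → P (τ + 1) = P τ + p α n := by
  let T : ℕ → ℂ → ℂ := fun j τ =>
    if j = n then 0 else (p α j : ℂ) * exp (2 * π * I * (j - n) * τ) / (2 * π * I * (j - n))
  have hden : ∀ j : ℕ, j ≠ n → 2 * π * I * ((j : ℂ) - n) ≠ 0 := by
    intro j hj
    refine mul_ne_zero two_pi_I_ne_zero (sub_ne_zero.mpr ?_)
    exact_mod_cast hj
  have hT : ∀ j τ, HasDerivAt (T j)
      ((p α j : ℂ) * exp (2 * π * I * (j - n) * τ) - if j = n then (p α n : ℂ) else 0) τ := by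
    intro j τ
    by_cases hj : j = n
    · subst hj
      simpa [T] using! hasDerivAt_const τ (0 : ℂ)
    · simp only [T, if_neg hj, sub_zero]
      have h1 : HasDerivAt (fun τ : ℂ => 2 * π * I * ((j : ℂ) - n) * τ)
          (2 * π * I * ((j : ℂ) - n)) τ := by
        simpa using! (hasDerivAt_id τ).const_mul (2 * π * I * ((j : ℂ) - n))
      have h2 := (h1.cexp.const_mul (p α j : ℂ)).div_const (2 * π * I * ((j : ℂ) - n))
      rwa [← mul_assoc, mul_div_cancel_right₀ _ (hden j hj)] at h2
  refine ⟨fun τ => p α n * τ + ∑' j, T j τ, fun τ hτ => ?_, fun τ _ => ?_⟩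
  · obtain ⟨δ, hδ0, hδ⟩ := exists_between hτ
    obtain ⟨Δ, hΔ⟩ := exists_gt τ.im
    let U : Set ℂ := {w | δ < w.im} ∩ {w | w.im < Δ}
    have hU : IsOpen U := (isOpen_lt continuous_const continuous_im).inter
      (isOpen_lt continuous_im continuous_const)
    have hbound : ∀ j, ∀ w ∈ U, ‖T j w‖ ≤
        Real.exp (2 * π * n * Δ) * (p α j * Real.exp (-(2 * π * δ)) ^ j) := by
      intro j w hw
      have hw1 : δ < w.im := hw.1
      have hw2 : w.im < Δ := hw.2
      have hp := p_nonneg hα j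
      by_cases hj : j = n
      · simp only [T, if_pos hj, norm_zero]
        positivity
      · simp only [T, if_neg hj]
        rw [norm_div, norm_mul, norm_real, Real.norm_of_nonneg hp, norm_exp]
        have e1 : (2 * π * I * ((j : ℂ) - n) * w).re = 2 * π * n * w.im - 2 * π * j * w.im := by
          simp
          ring
        have e2 : 1 ≤ ‖2 * π * I * ((j : ℂ) - n)‖ := by
          have h1 : (1 : ℝ) ≤ ‖(j : ℂ) - n‖ := by
            have : (1 : ℤ) ≤ |(j : ℤ) - n| := Int.one_le_abs (by omega)
            have h2 : ‖(j : ℂ) - n‖ = ((|(j : ℤ) - n| : ℤ) : ℝ) := by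
              have h3 : (j : ℂ) - n = ((j - n : ℤ) : ℂ) := by push_cast; rfl
              rw [h3, Complex.norm_intCast, Int.cast_abs]
            rw [h2]
            exact_mod_cast this
          rw [norm_mul, norm_mul, norm_mul, norm_I, norm_real, Real.norm_of_nonneg Real.pi_pos.le]
          have h3 : ‖(2 : ℂ)‖ = 2 := by simp
          have h4 := mul_le_mul Real.pi_gt_three.le h1 zero_le_one Real.pi_pos.le
          rw [h3]
          linarith
        rw [e1]
        refine (div_le_self (by positivity) e2).trans ?_
        rw [← Real.exp_nat_mul, mul_left_comm, ← Real.exp_add]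
        gcongr
        have hπ := Real.pi_pos
        have h1 : π * n * w.im ≤ π * n * Δ := by gcongr
        have h2 : π * j * δ ≤ π * j * w.im := by gcongr
        linarith
    have hsum : Summable fun j : ℕ =>
        Real.exp (2 * π * n * Δ) * (p α j * Real.exp (-(2 * π * δ)) ^ j) := by
      refine (summable_p_mul_pow hα (Real.exp_pos _).le ?_).mul_left _
      rw [Real.exp_lt_one_iff]
      have := Real.pi_pos
      nlinarith [mul_pos this hδ0]
    have hd : ∀ j, DifferentiableOn ℂ (T j) U := fun j w _ =>
      (hT j w).differentiableAt.differentiableWithinAt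
    have h1 := hasSum_deriv_of_summable_norm hsum hd hU hbound (z := τ) ⟨hδ, hΔ⟩
    have h2 : DifferentiableAt ℂ (fun w => ∑' j, T j w) τ :=
      (differentiableOn_tsum_of_summable_norm hsum hd hU hbound).differentiableAt
        (hU.mem_nhds ⟨hδ, hΔ⟩)
    simp only [(hT _ τ).deriv] at h1
    have h3 : HasSum (fun j : ℕ => (p α j : ℂ) * exp (2 * π * I * (j - n) * τ))
        (genSeries α τ * exp (-(2 * π * I * n * τ))) := by
      convert! (hasSum_genSeries hα hτ).mul_right (exp (-(2 * π * I * n * τ))) using 2 with j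
      rw [← exp_nat_mul, mul_assoc (p α j : ℂ), ← exp_add]
      congr 2
      ring
    have h4 := h1.unique (h3.sub (hasSum_ite_eq n (p α n : ℂ)))
    have h5 := ((hasDerivAt_id τ).const_mul (p α n : ℂ)).add h2.hasDerivAt
    rw [h4] at h5
    simpa using! h5
  · have : ∀ j, T j (τ + 1) = T j τ := by
      intro j
      simp only [T]
      congr 3
      have e : 2 * π * I * ((j : ℂ) - n) * (τ + 1) =
          2 * π * I * ((j : ℂ) - n) * τ + ((j - n : ℤ) : ℂ) * (2 * π * I) := by
        push_cast
        ring
      rw [e]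
      exact exp_periodic.int_mul _ _
    simp only [this]
    ring

/-- The modular transformation of the generating function at a point of a Ford circle: the
argument is sent to the line `Im = 1`. -/
theorem genSeries_fordPoint (α : ℝ) {h k : ℕ} (hk : 0 < k) (hc : h.Coprime k) (t : ℝ) :
    genSeries α (fordPoint h k t) =
      exp (α * π * I * dedekindSum h k) * ((k : ℂ) + I * t) ^ ((-(α / 2) : ℝ) : ℂ) *
        exp (α * π * (k + I * t) / (12 * k) - α * π / (12 * k * (k + I * t))) *
        genSeries α ((negInv h k + I * (k + I * t)) / k) := by
  have hkR : (0 : ℝ) < k := by exact_mod_cast hk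
  have hkC : (k : ℂ) ≠ 0 := by exact_mod_cast hk.ne'
  have hu : (k : ℂ) + I * t ≠ 0 := by simpa using add_I_mul_ne_zero hkR t
  have hus : (k : ℂ) + I * t ∈ slitPlane := by simpa using add_I_mul_mem_slitPlane hkR t
  set u : ℂ := (k : ℂ) + I * t with hudef
  have hure : 0 < (u⁻¹).re := by
    rw [inv_re]
    refine div_pos ?_ (normSq_pos.mpr hu)
    simpa [hudef] using hk
  have htr := logEta_transform hk (h := (h : ℤ)) (H := (negInv h k : ℤ))
    (mul_negInv_modEq h k hk.ne' hc) hure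
  have e1 : ((h : ℤ) + I * u⁻¹) / (k : ℂ) = fordPoint h k t := by
    rw [fordPoint, ← hudef]
    push_cast
    field_simp
  have e2 : (((negInv h k : ℤ) : ℂ) + I / u⁻¹) / (k : ℂ) = (negInv h k + I * u) / k := by
    push_cast
    rw [div_inv_eq_mul]
  have e3 : log u⁻¹ = -log u := log_inv u (slitPlane_arg_ne_pi hus)
  rw [e1, e2, e3, logEta, logEta] at htr
  push_cast at htr
  have e4 : fordPoint h k t = (h : ℂ) / k + I / (k * u) := rfl
  rw [genSeries, genSeries, cpow_def_of_ne_zero hu, ← exp_add, ← exp_add, ← exp_add]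
  congr 1
  have e5 : logEuler (fordPoint h k t) = logEuler ((negInv h k + I * u) / k) + log u / 2
      - π * I * dedekindSum h k - π * u / (12 * k) + π / (12 * k * u) := by
    have e6 : π * I * fordPoint h k t / 12 = π * I * h / (12 * k) - π / (12 * k * u) := by
      rw [e4]
      field_simp
      linear_combination I_sq
    have e7 : π * I * (((negInv h k : ℕ) : ℂ) + I * u) / k / 12 =
        π * I * negInv h k / (12 * k) - π * u / (12 * k) := by
      field_simp
      linear_combination (u : ℂ) * I_sq
    have e8 : π * I * ((h : ℂ) - negInv h k) / (12 * k) =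
        π * I * h / (12 * k) - π * I * negInv h k / (12 * k) := by ring
    rw [e6, ← mul_div_assoc, e7, e8] at htr
    linear_combination htr
  rw [e5]
  push_cast
  ring

/-! ### Estimates for the tails of the integrals -/

lemma half_add_le_norm_add_I_mul (σ t : ℝ) :
    (t + σ) / 2 ≤ ‖(σ : ℂ) + I * t‖ := by
  refine le_of_sq_le_sq ?_ (norm_nonneg _)
  rw [sq_norm_add_I_mul]
  nlinarith [sq_nonneg (σ - t)]

lemma integral_Ioi_norm_add_I_mul_rpow_le {σ r β : ℝ} (hσ : 1 ≤ σ) (hr : 0 ≤ r) (hβ : 0 < β) :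
    ∫ t in Set.Ioi r, ‖(σ : ℂ) + I * t‖ ^ (-(β + 1)) ≤ 2 ^ (β + 1) / β * (r + σ) ^ (-β) := by
  have hint : IntegrableOn (fun t : ℝ => (t + σ) ^ (-(β + 1))) (Set.Ioi r) :=
    integrableOn_add_rpow_Ioi_of_lt (by linarith) (by linarith)
  have hval : ∫ t in Set.Ioi r, (t + σ) ^ (-(β + 1)) = (r + σ) ^ (-β) / β := by
    have hd : ∀ x ∈ Set.Ici r, HasDerivAt (fun t : ℝ => -((t + σ) ^ (-β) / β))
        ((x + σ) ^ (-(β + 1))) x := by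
      intro x hx
      have hx' : r ≤ x := hx
      have h1 := (((hasDerivAt_id x).add_const σ).rpow_const (p := -β)
        (Or.inl (by simp only [id]; linarith))).div_const β |>.neg
      convert! h1 using 1
      simp only [id]
      rw [show -(β + 1) = -β - 1 by ring]
      field_simp
    have ht : Tendsto (fun t : ℝ => -((t + σ) ^ (-β) / β)) atTop (𝓝 0) := by
      have h1 : Tendsto (fun t : ℝ => (t + σ) ^ (-β)) atTop (𝓝 0) :=
        (tendsto_rpow_neg_atTop hβ).comp (tendsto_atTop_add_const_right _ _ tendsto_id)
      simpa using (h1.div_const β).neg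
    rw [integral_Ioi_of_hasDerivAt_of_tendsto' hd hint ht]
    ring
  calc ∫ t in Set.Ioi r, ‖(σ : ℂ) + I * t‖ ^ (-(β + 1))
      ≤ ∫ t in Set.Ioi r, 2 ^ (β + 1) * (t + σ) ^ (-(β + 1)) := by
        refine setIntegral_mono_on (integrable_norm_add_I_mul_rpow hσ (by linarith)).integrableOn
          (hint.const_mul _) measurableSet_Ioi fun t ht => ?_
        have ht' : r < t := ht
        have h1 := half_add_le_norm_add_I_mul σ t
        refine (Real.rpow_le_rpow_of_nonpos (by linarith) h1 (by linarith)).trans_eq ?_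
        rw [Real.div_rpow (by linarith) zero_le_two, Real.rpow_neg zero_le_two, div_inv_eq_mul,
          mul_comm]
    _ = _ := by
        rw [integral_const_mul, hval]
        ring

/-- Truncation of an integral along the line `Re u = σ` to the segment from `σ - i l` to `σ + i r`. -/
lemma norm_intervalIntegral_sub_integral_le {σ l r β C N : ℝ} {F : ℝ → ℂ} (hσ : 1 ≤ σ)
    (hl : 0 ≤ l) (hr : 0 ≤ r) (hβ : 0 < β) (hC : 0 ≤ C) (hN : 0 < N) (hNl : N ≤ l + σ)
    (hNr : N ≤ r + σ) (hF : Integrable F)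
    (hb : ∀ t : ℝ, ‖F t‖ ≤ C * ‖(σ : ℂ) + I * t‖ ^ (-(β + 1))) :
    ‖(∫ t in (-l)..r, F t) - ∫ t, F t‖ ≤ C * (2 * (2 ^ (β + 1) / β)) * N ^ (-β) := by
  have hsplit : (∫ t in (-l)..r, F t) - ∫ t, F t =
      -((∫ t in Set.Iic (-l), F t) + ∫ t in Set.Ioi r, F t) := by
    rw [← intervalIntegral.integral_Iic_sub_Iic hF.integrableOn hF.integrableOn,
      ← intervalIntegral.integral_Iic_add_Ioi (b := r) hF.integrableOn hF.integrableOn]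
    ring
  have hG := integrable_norm_add_I_mul_rpow (γ := β + 1) hσ (by linarith)
  have hmono : ∀ x : ℝ, N ≤ x + σ → 2 ^ (β + 1) / β * (x + σ) ^ (-β) ≤ 2 ^ (β + 1) / β * N ^ (-β) :=
    fun x hx => mul_le_mul_of_nonneg_left (Real.rpow_le_rpow_of_nonpos hN hx (by linarith))
      (by positivity)
  have hright : ‖∫ t in Set.Ioi r, F t‖ ≤ C * (2 ^ (β + 1) / β * N ^ (-β)) := by
    calc ‖∫ t in Set.Ioi r, F t‖ ≤ ∫ t in Set.Ioi r, C * ‖(σ : ℂ) + I * t‖ ^ (-(β + 1)) :=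
          norm_integral_le_of_norm_le (hG.const_mul C).integrableOn (Eventually.of_forall hb)
      _ ≤ _ := by
          rw [integral_const_mul]
          exact mul_le_mul_of_nonneg_left ((integral_Ioi_norm_add_I_mul_rpow_le hσ hr hβ).trans
            (hmono r hNr)) hC
  have hleft : ‖∫ t in Set.Iic (-l), F t‖ ≤ C * (2 ^ (β + 1) / β * N ^ (-β)) := by
    have hrefl : ∫ t in Set.Iic (-l), F t = ∫ t in Set.Ioi l, F (-t) := by
      simp
    rw [hrefl]
    calc ‖∫ t in Set.Ioi l, F (-t)‖ ≤ ∫ t in Set.Ioi l, C * ‖(σ : ℂ) + I * t‖ ^ (-(β + 1)) := by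
          refine norm_integral_le_of_norm_le (hG.const_mul C).integrableOn
            (Eventually.of_forall fun t => (hb (-t)).trans_eq ?_)
          have e : ‖(σ : ℂ) + I * ((-t : ℝ) : ℂ)‖ = ‖(σ : ℂ) + I * t‖ := by
            rw [← sq_eq_sq₀ (norm_nonneg _) (norm_nonneg _), sq_norm_add_I_mul, sq_norm_add_I_mul,
              neg_sq]
          rw [e]
      _ ≤ _ := by
          rw [integral_const_mul]
          exact mul_le_mul_of_nonneg_left ((integral_Ioi_norm_add_I_mul_rpow_le hσ hl hβ).trans
            (hmono l hNl)) hC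
  rw [hsplit, norm_neg]
  refine (norm_add_le _ _).trans ((add_le_add hleft hright).trans_eq ?_)
  ring

lemma norm_exp_div_le {b : ℝ} (hb : 0 ≤ b) {u : ℂ} (hu : 1 ≤ ‖u‖) :
    ‖exp (b / u)‖ ≤ Real.exp b := by
  rw [norm_exp]
  refine Real.exp_le_exp.mpr ((re_le_norm _).trans ?_)
  rw [norm_div, norm_real, Real.norm_of_nonneg hb]
  exact div_le_self hb hu

/-- The part of the generating function without polar terms, in the coordinate `u` of a Ford
circle, multiplied by `exp (α π u / (12 k))`. For `M > α / 24` all exponentials in its `q`-expansion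
decay as `Re u` grows. -/
noncomputable def regularPart (α : ℝ) (M k H : ℕ) (u : ℂ) : ℂ :=
  exp (α * π * u / (12 * k)) * (genSeries α ((H + I * u) / k) -
    ∑ m ∈ Finset.range M, (p α m : ℂ) * exp (2 * π * I * ((H + I * u) / k)) ^ m)

lemma im_add_I_mul_div {k : ℕ} (H : ℕ) (u : ℂ) : (((H : ℂ) + I * u) / k).im = u.re / k := by
  rw [div_natCast_im]
  simp

lemma differentiableAt_regularPart (α : ℝ) (M : ℕ) {k : ℕ} (hk : 0 < k) (H : ℕ) {u : ℂ}
    (hu : 0 < u.re) : DifferentiableAt ℂ (regularPart α M k H) u := by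
  have h1 : DifferentiableAt ℂ (fun u : ℂ => genSeries α ((H + I * u) / k)) u := by
    refine (differentiableAt_genSeries α ?_).comp (f := fun u : ℂ => ((H : ℂ) + I * u) / k) u
      (by fun_prop)
    rw [im_add_I_mul_div]
    positivity
  unfold regularPart
  fun_prop

lemma summable_p_mul_exp {α : ℝ} (hα : 0 ≤ α) (M : ℕ) :
    Summable fun m : ℕ => p α (m + M) * Real.exp (-(2 * π * ((m + M : ℕ) - α / 24))) := by
  have hlt : Real.exp (-(2 * π)) < 1 := by
    rw [Real.exp_lt_one_iff]
    linarith [Real.pi_pos]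
  have h1 := (summable_p_mul_pow hα (Real.exp_pos _).le hlt).mul_right (Real.exp (2 * π * (α / 24)))
  refine ((summable_nat_add_iff M).mpr h1).congr fun m => ?_
  rw [← Real.exp_nat_mul, mul_assoc, ← Real.exp_add]
  congr 2
  ring

lemma norm_regularPart_le {α : ℝ} (hα : 0 ≤ α) {M : ℕ} (hM : ∀ m, M ≤ m → α / 24 ≤ m) {k : ℕ}
    (hk : 0 < k) (H : ℕ) {u : ℂ} (hu : k ≤ u.re) :
    ‖regularPart α M k H u‖ ≤
      ∑' m : ℕ, p α (m + M) * Real.exp (-(2 * π * ((m + M : ℕ) - α / 24))) := by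
  have hkR : (0 : ℝ) < k := by exact_mod_cast hk
  have him : 0 < (((H : ℂ) + I * u) / k).im := by
    rw [im_add_I_mul_div]
    exact div_pos (hkR.trans_le hu) hkR
  have h1 := (hasSum_nat_add_iff' M).mpr (hasSum_genSeries hα him)
  have h2 := h1.mul_left (exp (α * π * u / (12 * k)))
  rw [regularPart, ← h2.tsum_eq]
  refine tsum_of_norm_bounded (summable_p_mul_exp hα M).hasSum fun m => ?_
  rw [norm_mul, norm_mul, norm_pow, norm_exp_two_pi_I_mul, im_add_I_mul_div, norm_exp, norm_real,
    Real.norm_of_nonneg (p_nonneg hα _), ← Real.exp_nat_mul, mul_left_comm, ← Real.exp_add]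
  refine mul_le_mul_of_nonneg_left (Real.exp_le_exp.mpr ?_) (p_nonneg hα _)
  have e1 : (α * π * u / (12 * k) : ℂ).re = 2 * π * (α / 24) * (u.re / k) := by
    have : (α * π * u / (12 * k) : ℂ) = ((α * π / (12 * k) : ℝ) : ℂ) * u := by
      push_cast
      ring
    rw [this, re_ofReal_mul]
    field_simp
    ring
  have hx : 1 ≤ u.re / k := (one_le_div hkR).mpr hu
  have hm : α / 24 ≤ ((m + M : ℕ) : ℝ) := hM _ (Nat.le_add_left _ _)
  have hπ := Real.pi_pos
  rw [e1]
  have h3 : 0 ≤ 2 * π * (((m + M : ℕ) : ℝ) - α / 24) := by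
    have : 0 ≤ ((m + M : ℕ) : ℝ) - α / 24 := by linarith
    positivity
  nlinarith [mul_le_mul_of_nonneg_left hx h3]

/-- The contribution of the regular part is small: its arc can be replaced, by Cauchy's theorem, by
the other three sides of a rectangle on which `‖u‖ ≥ N / 2`. -/
lemma norm_integral_regularPart_le {α β b : ℝ} (hα : 0 ≤ α) (hβ : 0 < β) (hb : 0 ≤ b) {M : ℕ}
    (hM : ∀ m, M ≤ m → α / 24 ≤ m) {N k l r : ℕ} (hk : 0 < k) (hkN : k ≤ N)
    (hl : l ∈ Finset.Ioc (N - k) N) (hr : r ∈ Finset.Ioc (N - k) N) (H : ℕ) :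
    ‖∫ t in (-(l : ℝ))..r, ((k : ℂ) + I * t) ^ ((-(β + 1) : ℝ) : ℂ) * exp (b / (k + I * t)) *
        regularPart α M k H (k + I * t)‖ ≤
      8 * 2 ^ β * (Real.exp b *
        ∑' m : ℕ, p α (m + M) * Real.exp (-(2 * π * ((m + M : ℕ) - α / 24)))) * (N : ℝ) ^ (-β) := by
  set C := Real.exp b *
    ∑' m : ℕ, p α (m + M) * Real.exp (-(2 * π * ((m + M : ℕ) - α / 24))) with hC
  have hC0 : 0 ≤ C := mul_nonneg (Real.exp_pos _).le
    (tsum_nonneg fun m => mul_nonneg (p_nonneg hα _) (Real.exp_pos _).le)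
  rw [Finset.mem_Ioc] at hl hr
  have hkR : (1 : ℝ) ≤ k := by exact_mod_cast hk
  have hNR : (1 : ℝ) ≤ N := hkR.trans (by exact_mod_cast hkN)
  have hkl : (N : ℝ) ≤ k + l := by exact_mod_cast (by omega : N ≤ k + l)
  have hkr : (N : ℝ) ≤ k + r := by exact_mod_cast (by omega : N ≤ k + r)
  have hlN : (l : ℝ) ≤ N := by exact_mod_cast hl.2
  have hrN : (r : ℝ) ≤ N := by exact_mod_cast hr.2
  let G : ℂ → ℂ := fun u => u ^ ((-(β + 1) : ℝ) : ℂ) * exp (b / u) * regularPart α M k H u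
  have hGd : ∀ u : ℂ, 0 < u.re → DifferentiableAt ℂ G u := by
    intro u hu
    have hu0 : u ≠ 0 := fun h => by simp [h] at hu
    have h1 : DifferentiableAt ℂ (fun u : ℂ => u ^ ((-(β + 1) : ℝ) : ℂ)) u :=
      differentiableAt_id.cpow_const (mem_slitPlane_iff.mpr (Or.inl hu))
    have h2 : DifferentiableAt ℂ (fun u : ℂ => exp (b / u)) u := by
      fun_prop (disch := assumption)
    exact (h1.mul h2).mul (differentiableAt_regularPart α M hk H hu)
  have hGb : ∀ u : ℂ, k ≤ u.re → (N : ℝ) / 2 ≤ ‖u‖ → ‖G u‖ ≤ C * ((N : ℝ) / 2) ^ (-(β + 1)) := by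
    intro u hu hun
    have h1 : 1 ≤ ‖u‖ := hkR.trans (hu.trans (re_le_norm u))
    simp only [G]
    rw [norm_mul, norm_mul, norm_cpow_real, hC]
    calc ‖u‖ ^ (-(β + 1)) * ‖exp (b / u)‖ * ‖regularPart α M k H u‖
        ≤ ((N : ℝ) / 2) ^ (-(β + 1)) * Real.exp b * _ :=
          mul_le_mul (mul_le_mul (Real.rpow_le_rpow_of_nonpos (by positivity) hun (by linarith))
            (norm_exp_div_le hb h1) (norm_nonneg _) (by positivity))
            (norm_regularPart_le hα hM hk H hu) (norm_nonneg _) (by positivity)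
      _ = _ := by ring
  -- The rectangle with the segment as its left side and of width `N`.
  have hcauchy := integral_boundary_rect_eq_zero_of_differentiableOn G
    ((k : ℂ) - l * I) (((k + N : ℝ) : ℂ) + r * I) (fun u hu => by
      refine (hGd u ?_).differentiableWithinAt
      have h1 := hu.1
      simp only [Set.mem_preimage] at h1
      have h2 := (Set.mem_uIcc.mp h1)
      simp at h2
      rcases h2 with h2 | h2 <;> linarith)
  simp only [sub_re, sub_im, add_re, add_im, natCast_re, natCast_im, mul_re, mul_im, I_re, I_im,
    ofReal_re, ofReal_im, mul_zero, mul_one, sub_zero, zero_sub, add_zero, zero_add, sub_self] at hcauchy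
  set K := C * ((N : ℝ) / 2) ^ (-(β + 1)) with hK
  have b1 : ‖∫ x in (k : ℝ)..(k + N : ℝ), G (x + ((-(l : ℝ) : ℝ) : ℂ) * I)‖ ≤ K * N := by
    refine (intervalIntegral.norm_integral_le_of_norm_le_const (C := K) fun x hx => ?_).trans_eq
      (by simp)
    rw [Set.uIoc_of_le (by linarith)] at hx
    refine hGb _ (by simpa using hx.1.le) ?_
    have h1 := re_le_norm ((x : ℂ) + ((-(l : ℝ) : ℝ) : ℂ) * I)
    have h2 := neg_le_of_abs_le (abs_im_le_norm ((x : ℂ) + ((-(l : ℝ) : ℝ) : ℂ) * I))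
    rw [add_im, ofReal_im, im_ofReal_mul, I_im, mul_one, zero_add] at h2
    rw [add_re, ofReal_re, re_ofReal_mul, I_re, mul_zero, add_zero] at h1
    linarith [hx.1]
  have b2 : ‖∫ x in (k : ℝ)..(k + N : ℝ), G (x + ((r : ℝ) : ℂ) * I)‖ ≤ K * N := by
    refine (intervalIntegral.norm_integral_le_of_norm_le_const (C := K) fun x hx => ?_).trans_eq
      (by simp)
    rw [Set.uIoc_of_le (by linarith)] at hx
    refine hGb _ (by simpa using hx.1.le) ?_
    have h1 := re_le_norm ((x : ℂ) + ((r : ℝ) : ℂ) * I)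
    have h2 := im_le_norm ((x : ℂ) + ((r : ℝ) : ℂ) * I)
    rw [add_re, ofReal_re, re_ofReal_mul, I_re, mul_zero, add_zero] at h1
    rw [add_im, ofReal_im, im_ofReal_mul, I_im, mul_one, zero_add] at h2
    linarith [hx.1]
  have b3 : ‖∫ y in (-(l : ℝ))..r, G (((k + N : ℝ) : ℂ) + y * I)‖ ≤ K * (2 * N) := by
    refine (intervalIntegral.norm_integral_le_of_norm_le_const (C := K) fun y hy => ?_).trans ?_
    · refine hGb _ (by simp) ?_
      have h1 := re_le_norm (((k + N : ℝ) : ℂ) + y * I)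
      simp at h1
      push_cast
      linarith
    · have h4 : |(r : ℝ) - -(l : ℝ)| ≤ 2 * N := by
        rw [abs_of_nonneg (by linarith)]
        linarith
      exact mul_le_mul_of_nonneg_left h4 (by positivity)
  have hI : ∫ t in (-(l : ℝ))..r, ((k : ℂ) + I * t) ^ ((-(β + 1) : ℝ) : ℂ) * exp (b / (k + I * t)) *
        regularPart α M k H (k + I * t) = ∫ y in (-(l : ℝ))..r, G ((k : ℝ) + y * I) := by
    refine intervalIntegral.integral_congr fun t _ => ?_
    simp only [G, ofReal_natCast, mul_comm (t : ℂ) I]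
  rw [hI]
  have hfin : ‖∫ y in (-(l : ℝ))..r, G ((k : ℝ) + y * I)‖ ≤ K * N + K * N + K * (2 * N) := by
    have e : I • (∫ y in (-(l : ℝ))..r, G ((k : ℝ) + y * I)) =
        (∫ x in (k : ℝ)..(k + N : ℝ), G (x + ((-(l : ℝ) : ℝ) : ℂ) * I))
        - (∫ x in (k : ℝ)..(k + N : ℝ), G (x + ((r : ℝ) : ℂ) * I))
        + I • (∫ y in (-(l : ℝ))..r, G (((k + N : ℝ) : ℂ) + y * I)) := by
      linear_combination -hcauchy
    have e2 : ‖∫ y in (-(l : ℝ))..r, G ((k : ℝ) + y * I)‖ =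
        ‖I • (∫ y in (-(l : ℝ))..r, G ((k : ℝ) + y * I))‖ := by
      rw [norm_smul, norm_I, one_mul]
    rw [e2, e]
    refine (norm_add_le _ _).trans (add_le_add ((norm_sub_le _ _).trans (add_le_add b1 b2)) ?_)
    rwa [norm_smul, norm_I, one_mul]
  refine hfin.trans_eq ?_
  have hN0 : (0 : ℝ) < N := by linarith
  rw [hK, Real.div_rpow hN0.le zero_le_two, Real.rpow_neg zero_le_two, div_inv_eq_mul,
    Real.rpow_add_one two_ne_zero, show -(β + 1) = -β - 1 by ring, Real.rpow_sub_one hN0.ne']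
  field_simp
  ring

/-! ### The integral along one arc -/

lemma sq_nu {α : ℝ} {n : ℕ} (hn : α / 24 < n) : nu α n ^ 2 = n - α / 24 :=
  Real.sq_sqrt (by linarith)

lemma sq_mu {α : ℝ} {m : ℕ} (hm : m ≤ α / 24) : mu α m ^ 2 = α / 24 - m :=
  Real.sq_sqrt (by linarith)

lemma natCast_add_I_mul_ne_zero {k : ℕ} (hk : 0 < k) (t : ℝ) : (k : ℂ) + I * t ≠ 0 := by
  simpa using add_I_mul_ne_zero (σ := k) (by exact_mod_cast hk) t

lemma hasDerivAt_fordPoint (h : ℕ) {k : ℕ} (hk : 0 < k) (t : ℝ) :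
    HasDerivAt (fordPoint h k) (1 / (k * ((k : ℂ) + I * t) ^ 2)) t := by
  have hu := natCast_add_I_mul_ne_zero hk t
  have hkC : (k : ℂ) ≠ 0 := by exact_mod_cast hk.ne'
  have h1 : HasDerivAt (fun t : ℝ => (k : ℂ) * ((k : ℂ) + I * t)) (k * (I * 1)) t :=
    ((((hasDerivAt_id (t : ℂ)).comp_ofReal).const_mul I).const_add (k : ℂ)).const_mul _
  have h2 := ((hasDerivAt_const t I).div h1 (mul_ne_zero hkC hu)).const_add ((h : ℂ) / k)
  convert! h2 using 1
  field_simp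
  linear_combination I_sq

/-- The number of modulus one `exp (α π i s(h, k) - 2 π i n h / k)` common to the integrands on the arc
at `h / k`. -/
noncomputable def arcFactor (α : ℝ) (n h k : ℕ) : ℂ :=
  exp (α * π * I * dedekindSum h k - 2 * π * I * n * h / k)

lemma norm_arcFactor (α : ℝ) (n h k : ℕ) : ‖arcFactor α n h k‖ = 1 := by
  have : (α * π * I * dedekindSum h k - 2 * π * I * n * h / k : ℂ) =
      ((α * π * dedekindSum h k - 2 * π * n * h / k : ℝ) : ℂ) * I := by
    push_cast
    ring
  rw [arcFactor, this, norm_exp_ofReal_mul_I]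

lemma kloosterman_eq_sum_arcFactor (α : ℝ) (k n m : ℕ) :
    kloosterman α k n m = ∑ h ∈ (Finset.range k).filter (fun h => Nat.Coprime h k),
      arcFactor α n h k * exp (2 * π * I * m * negInv h k / k) := by
  refine Finset.sum_congr rfl fun h _ => ?_
  rw [arcFactor, ← exp_add]
  congr 1
  ring

lemma norm_kloosterman_le (α : ℝ) (k n m : ℕ) : ‖kloosterman α k n m‖ ≤ k := by
  rw [kloosterman_eq_sum_arcFactor]
  refine (norm_sum_le_of_le _ (fun h _ => ?_) (f := fun h =>
    arcFactor α n h k * exp (2 * π * I * m * negInv h k / k)) (n := fun _ => 1)).trans ?_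
  · have : (2 * π * I * m * negInv h k / k : ℂ) = ((2 * π * m * negInv h k / k : ℝ) : ℂ) * I := by
      push_cast
      ring
    rw [norm_mul, norm_arcFactor, one_mul, this, norm_exp_ofReal_mul_I]
  · rw [Finset.sum_const, nsmul_eq_mul, mul_one]
    exact_mod_cast (Finset.card_filter_le _ _).trans_eq (Finset.card_range k)

/-- The integrand in the coordinate `u = k + i t` of the Ford circle at `h / k`, after the modular
transformation: the factors `exp (-2 π i n τ)` and `exp (-α π / (12 k u))` combine to
`exp (2 π ν² / (k u))`. -/
lemma integrand_fordPoint {α : ℝ} {n h k : ℕ} (hn : α / 24 < n) (hk : 0 < k)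
    (hc : h.Coprime k) (t : ℝ) :
    genSeries α (fordPoint h k t) * exp (-(2 * π * I * n * fordPoint h k t)) *
        (1 / (k * ((k : ℂ) + I * t) ^ 2)) =
      arcFactor α n h k / k * (((k : ℂ) + I * t) ^ ((-(α / 2 + 1 + 1) : ℝ) : ℂ) *
        exp (((2 * π * nu α n ^ 2 / k : ℝ) : ℂ) / (k + I * t)) *
        (exp (α * π * (k + I * t) / (12 * k)) *
          genSeries α ((negInv h k + I * (k + I * t)) / k))) := by
  have hu := natCast_add_I_mul_ne_zero hk t
  have hkC : (k : ℂ) ≠ 0 := by exact_mod_cast hk.ne'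
  rw [genSeries_fordPoint α hk hc, sq_nu hn, fordPoint]
  set u : ℂ := (k : ℂ) + I * t
  have e1 : u ^ ((-(α / 2 + 1 + 1) : ℝ) : ℂ) = u ^ ((-(α / 2) : ℝ) : ℂ) / u ^ 2 := by
    rw [← cpow_natCast u 2, ← cpow_sub _ _ hu]
    congr 1
    push_cast
    ring
  have e2 : -(2 * π * I * n * ((h : ℂ) / k + I / (k * u))) =
      -(2 * π * I * n * h / k) + 2 * π * n / (k * u) := by
    field_simp
    linear_combination (-(n : ℂ)) * I_sq
  have e3 : exp (α * π * I * dedekindSum h k) * exp (α * π * u / (12 * k) - α * π / (12 * k * u)) *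
      exp (-(2 * π * I * n * h / k) + 2 * π * n / (k * u)) =
      arcFactor α n h k * exp (((2 * π * (n - α / 24) / k : ℝ) : ℂ) / u) *
        exp (α * π * u / (12 * k)) := by
    rw [arcFactor, ← exp_add, ← exp_add, ← exp_add, ← exp_add]
    congr 1
    push_cast
    field_simp
    ring
  rw [e1, e2]
  calc _ = exp (α * π * I * dedekindSum h k) * exp (α * π * u / (12 * k) - α * π / (12 * k * u)) *
      exp (-(2 * π * I * n * h / k) + 2 * π * n / (k * u)) * u ^ ((-(α / 2) : ℝ) : ℂ) / u ^ 2 / k *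
      genSeries α ((negInv h k + I * u) / k) := by
        field_simp
    _ = _ := by
        rw [e3]
        ring

/-- Separation of the polar terms `m < M` of the `q`-expansion from the regular part. -/
lemma exp_mul_genSeries_eq {α : ℝ} {M : ℕ} (hM : ∀ m, m < M → (m : ℝ) ≤ α / 24) {k : ℕ}
    (hk : 0 < k) (H : ℕ) (u : ℂ) :
    exp (α * π * u / (12 * k)) * genSeries α ((H + I * u) / k) =
      (∑ m ∈ Finset.range M, (p α m : ℂ) * exp (2 * π * I * m * H / k) *
        exp (((2 * π * mu α m ^ 2 / k : ℝ) : ℂ) * u)) + regularPart α M k H u := by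
  have hkC : (k : ℂ) ≠ 0 := by exact_mod_cast hk.ne'
  rw [regularPart, mul_sub, Finset.mul_sum]
  have : ∀ m ∈ Finset.range M, exp (α * π * u / (12 * k)) *
      ((p α m : ℂ) * exp (2 * π * I * ((H + I * u) / k)) ^ m) =
      (p α m : ℂ) * exp (2 * π * I * m * H / k) *
        exp (((2 * π * mu α m ^ 2 / k : ℝ) : ℂ) * u) := by
    intro m hm
    rw [sq_mu (hM m (Finset.mem_range.mp hm)), ← exp_nat_mul, mul_left_comm,
      mul_assoc (p α m : ℂ), ← exp_add,
      ← exp_add]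
    congr 2
    push_cast
    field_simp
    linear_combination (576 * (m : ℂ) * u) * I_sq
  rw [Finset.sum_congr rfl this]
  ring

lemma norm_cpow_mul_exp_le {β ν μ : ℝ} {k : ℕ} (hk : 0 < k) (t : ℝ) :
    ‖((k : ℂ) + I * t) ^ ((-(β + 1) : ℝ) : ℂ) * exp (((2 * π * μ ^ 2 / k : ℝ) : ℂ) * (k + I * t)
        + ((2 * π * ν ^ 2 / k : ℝ) : ℂ) / (k + I * t))‖ ≤
      Real.exp (2 * π * μ ^ 2 + 2 * π * ν ^ 2) * ‖((k : ℝ) : ℂ) + I * t‖ ^ (-(β + 1)) := by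
  have hk1 : (1 : ℝ) ≤ k := by exact_mod_cast hk
  have h1 : 1 ≤ ‖(k : ℂ) + I * t‖ := by simpa using hk1.trans (le_norm_add_I_mul k t)
  rw [norm_mul, norm_cpow_real, exp_add, norm_mul, Real.exp_add, mul_comm, ofReal_natCast]
  have h2 : ‖exp (((2 * π * μ ^ 2 / k : ℝ) : ℂ) * (k + I * t))‖ = Real.exp (2 * π * μ ^ 2) := by
    rw [norm_exp, re_ofReal_mul]
    congr 1
    simp
    field_simp
  have h3 : ‖exp (((2 * π * ν ^ 2 / k : ℝ) : ℂ) / (k + I * t))‖ ≤ Real.exp (2 * π * ν ^ 2) :=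
    (norm_exp_div_le (by positivity) h1).trans
      (Real.exp_le_exp.mpr (div_le_self (by positivity) hk1))
  rw [h2]
  gcongr

lemma continuous_cpow_mul_exp {β b : ℝ} (c : ℝ) {k : ℕ} (hk : 0 < k) :
    Continuous fun t : ℝ => ((k : ℂ) + I * t) ^ ((-(β + 1) : ℝ) : ℂ) *
      exp ((c : ℂ) * (k + I * t) + (b : ℂ) / (k + I * t)) := by
  have h1 : Continuous fun t : ℝ => ((k : ℂ) + I * t) ^ ((-(β + 1) : ℝ) : ℂ) := by
    simpa using continuous_add_I_mul_cpow (σ := k) (by exact_mod_cast hk) (-(β + 1))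
  refine h1.mul (continuous_exp.comp ?_)
  exact Continuous.add (by fun_prop)
    (continuous_const.div (by fun_prop) fun t => natCast_add_I_mul_ne_zero hk t)

/-- The integral over an arc is the sum of the contributions of the polar terms, evaluated as if
the arc were the whole circle, up to an error uniform in `H` and in `k ≤ N`. -/
theorem exists_norm_arc_integral_sub_le {α : ℝ} (hα : 0 < α) {n : ℕ} (hn : α / 24 < n) {M : ℕ}
    (hM : ∀ m, m < M → (m : ℝ) ≤ α / 24) (hM' : ∀ m, M ≤ m → α / 24 ≤ m) :
    ∃ C : ℝ, ∀ N k l r H : ℕ, 0 < k → k ≤ N → l ∈ Finset.Ioc (N - k) N →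
      r ∈ Finset.Ioc (N - k) N →
      ‖(∫ t in (-(l : ℝ))..r, ((k : ℂ) + I * t) ^ ((-(α / 2 + 1 + 1) : ℝ) : ℂ) *
          exp (((2 * π * nu α n ^ 2 / k : ℝ) : ℂ) / (k + I * t)) *
          (exp (α * π * (k + I * t) / (12 * k)) * genSeries α ((H + I * (k + I * t)) / k))) -
        ∑ m ∈ Finset.range M, (p α m : ℂ) * exp (2 * π * I * m * H / k) *
          ((2 * π * (mu α m / nu α n) ^ (α / 2 + 1) *
            besselI (α / 2 + 1) (4 * π / k * nu α n * mu α m) : ℝ) : ℂ)‖ ≤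
      C * (N : ℝ) ^ (-(α / 2 + 1)) := by
  set β : ℝ := α / 2 + 1 with hβdef
  have hβ : 0 < β := by linarith
  have hν : 0 < nu α n := Real.sqrt_pos.mpr (by linarith)
  -- The first sum bounds the completion of the arcs in the polar terms, the second summand the
  -- integral of the regular part.
  refine ⟨∑ m ∈ Finset.range M, p α m * (Real.exp (2 * π * mu α m ^ 2 + 2 * π * nu α n ^ 2) *
      (2 * (2 ^ (β + 1) / β))) + 8 * 2 ^ β * (Real.exp (2 * π * nu α n ^ 2) *
        ∑' m : ℕ, p α (m + M) * Real.exp (-(2 * π * ((m + M : ℕ) - α / 24)))),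
    fun N k l r H hk hkN hl hr => ?_⟩
  have hk1 : (1 : ℝ) ≤ k := by exact_mod_cast hk
  have hN0 : (0 : ℝ) < N := by exact_mod_cast hk.trans_le hkN
  have hl' := Finset.mem_Ioc.mp hl
  have hr' := Finset.mem_Ioc.mp hr
  set b : ℝ := 2 * π * nu α n ^ 2 / k with hb
  have hb0 : 0 ≤ b := by positivity
  let F : ℕ → ℝ → ℂ := fun m t => ((k : ℂ) + I * t) ^ ((-(β + 1) : ℝ) : ℂ) *
    exp (((2 * π * mu α m ^ 2 / k : ℝ) : ℂ) * (k + I * t) + (b : ℂ) / (k + I * t))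
  let a : ℕ → ℂ := fun m => (p α m : ℂ) * exp (2 * π * I * m * H / k)
  let R : ℝ → ℂ := fun t => ((k : ℂ) + I * t) ^ ((-(β + 1) : ℝ) : ℂ) * exp (b / (k + I * t)) *
    regularPart α M k H (k + I * t)
  have hFb : ∀ m t, ‖F m t‖ ≤ Real.exp (2 * π * mu α m ^ 2 + 2 * π * nu α n ^ 2) *
      ‖((k : ℝ) : ℂ) + I * t‖ ^ (-(β + 1)) := fun m t => norm_cpow_mul_exp_le hk t
  have hFc : ∀ m, Continuous (F m) := fun m => continuous_cpow_mul_exp _ hk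
  have hFi : ∀ m, Integrable (F m) := fun m =>
    ((integrable_norm_add_I_mul_rpow hk1 (by linarith)).const_mul _).mono'
      (hFc m).aestronglyMeasurable (Eventually.of_forall (hFb m))
  have hRc : Continuous R := by
    have h1 := continuous_cpow_mul_exp (β := β) (b := b) 0 hk
    simp only [ofReal_zero, zero_mul, zero_add] at h1
    refine h1.mul (continuous_iff_continuousAt.mpr fun t => ?_)
    have h2 := (differentiableAt_regularPart α M hk H (u := (k : ℂ) + I * t)
      (by simpa using hk)).continuousAt
    exact ContinuousAt.comp (f := fun t : ℝ => (k : ℂ) + I * t) h2 (by fun_prop)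
  have hsplit : (∫ t in (-(l : ℝ))..r, ((k : ℂ) + I * t) ^ ((-(β + 1) : ℝ) : ℂ) *
      exp ((b : ℂ) / (k + I * t)) *
      (exp (α * π * (k + I * t) / (12 * k)) * genSeries α ((H + I * (k + I * t)) / k))) =
      (∑ m ∈ Finset.range M, a m * ∫ t in (-(l : ℝ))..r, F m t) + ∫ t in (-(l : ℝ))..r, R t := by
    have hSc : Continuous fun t => ∑ m ∈ Finset.range M, a m * F m t :=
      continuous_finsetSum _ fun m _ => continuous_const.mul (hFc m)
    simp only [← intervalIntegral.integral_const_mul]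
    rw [← intervalIntegral.integral_finsetSum (f := fun m t => a m * F m t) fun m _ =>
        Continuous.intervalIntegrable (continuous_const.mul (hFc m)) _ _,
      ← intervalIntegral.integral_add (f := fun t => ∑ m ∈ Finset.range M, a m * F m t) (g := R)
        (hSc.intervalIntegrable _ _) (hRc.intervalIntegrable _ _)]
    refine intervalIntegral.integral_congr fun t _ => ?_
    simp only [F, a, R]
    rw [exp_mul_genSeries_eq hM hk, mul_add, Finset.mul_sum]
    congr 1
    refine Finset.sum_congr rfl fun m _ => ?_
    rw [exp_add]
    ring
  have hbes : ∀ m, ((2 * π * (mu α m / nu α n) ^ β *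
      besselI β (4 * π / k * nu α n * mu α m) : ℝ) : ℂ) = ∫ t, F m t := fun m =>
    (integral_eq_besselI hk hβ hν (Real.sqrt_nonneg _)).symm
  rw [hsplit, add_sub_right_comm, ← Finset.sum_sub_distrib, add_mul, Finset.sum_mul]
  refine (norm_add_le _ _).trans (add_le_add (norm_sum_le_of_le _ fun m _ => ?_) ?_)
  · have ha : ‖a m‖ = p α m := by
      have : (2 * π * I * m * H / k : ℂ) = ((2 * π * m * H / k : ℝ) : ℂ) * I := by
        push_cast
        ring
      simp only [a]
      rw [norm_mul, this, norm_exp_ofReal_mul_I, mul_one, norm_real,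
        Real.norm_of_nonneg (p_nonneg hα.le m)]
    have htail := norm_intervalIntegral_sub_integral_le (F := F m) hk1 l.cast_nonneg r.cast_nonneg
      hβ (Real.exp_pos _).le hN0 (by exact_mod_cast (by omega : N ≤ l + k))
      (by exact_mod_cast (by omega : N ≤ r + k)) (hFi m) (hFb m)
    rw [hbes]
    change ‖a m * _ - a m * _‖ ≤ _
    rw [← mul_sub, norm_mul, ha, mul_assoc]
    exact mul_le_mul_of_nonneg_left htail (p_nonneg hα.le m)
  · refine (norm_integral_regularPart_le hα.le hβ hb0 hM' hk hkN hl hr H).trans ?_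
    have h1 : Real.exp b ≤ Real.exp (2 * π * nu α n ^ 2) :=
      Real.exp_le_exp.mpr (div_le_self (by positivity) hk1)
    have h2 : 0 ≤ ∑' m : ℕ, p α (m + M) * Real.exp (-(2 * π * ((m + M : ℕ) - α / 24))) :=
      tsum_nonneg fun m => mul_nonneg (p_nonneg hα.le _) (Real.exp_pos _).le
    gcongr

/-! ### Convergence of the series and passage to the limit -/

/-- Absolute convergence: `A_k` is at most `k` in modulus, and the Bessel factor is
`O (k ^ (-α / 2 - 1))`. -/
lemma summable_seriesTerm {α : ℝ} (hα : 0 < α) (n m : ℕ) :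
    Summable fun k : ℕ => seriesTerm α n m (k + 1) := by
  set β : ℝ := α / 2 + 1 with hβdef
  have hβ : 0 < β := by linarith
  have hπ := Real.pi_pos
  set x : ℝ := 4 * π * nu α n * mu α m with hx
  have hx0 : 0 ≤ x := by
    have h1 : 0 ≤ nu α n := Real.sqrt_nonneg _
    have h2 : 0 ≤ mu α m := Real.sqrt_nonneg _
    positivity
  set S : ℝ := ∑' j : ℕ, (x / 2) ^ (2 * j) / ((j.factorial : ℝ) * Real.Gamma (β + (j : ℝ) + 1))
    with hS
  have hΓ : ∀ j : ℕ, 0 < (j.factorial : ℝ) * Real.Gamma (β + (j : ℝ) + 1) := fun j =>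
    mul_pos (by positivity) (Real.Gamma_pos_of_pos (by positivity))
  have hbes : ∀ k : ℕ, 0 < k → |besselI β (x / k)| ≤ (x / 2) ^ β * S * (k : ℝ) ^ (-β) := by
    intro k hk
    have hk0 : (0 : ℝ) < k := by exact_mod_cast hk
    have hk1 : (1 : ℝ) ≤ k := by exact_mod_cast hk
    have hle : x / k / 2 ≤ x / 2 := by
      gcongr
      exact div_le_self hx0 hk1
    have h0 : 0 ≤ x / k / 2 := by positivity
    have hS1 : ∑' j : ℕ, (x / k / 2) ^ (2 * j) /
        ((j.factorial : ℝ) * Real.Gamma (β + (j : ℝ) + 1)) ≤ S := by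
      refine Summable.tsum_le_tsum (fun j => ?_) (summable_besselI_series hβ _)
        (summable_besselI_series hβ _)
      exact div_le_div_of_nonneg_right (pow_le_pow_left₀ h0 hle _) (hΓ j).le
    have hS0 : 0 ≤ ∑' j : ℕ, (x / k / 2) ^ (2 * j) /
        ((j.factorial : ℝ) * Real.Gamma (β + (j : ℝ) + 1)) :=
      tsum_nonneg fun j => div_nonneg (pow_nonneg h0 _) (hΓ j).le
    rw [besselI, abs_of_nonneg (by positivity)]
    have e : (x / k / 2) ^ β = (x / 2) ^ β * (k : ℝ) ^ (-β) := by
      rw [div_right_comm, Real.div_rpow (by positivity) hk0.le, Real.rpow_neg hk0.le, div_eq_mul_inv]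
    rw [e, mul_right_comm]
    gcongr
  have hb : ∀ k : ℕ, 0 < k →
      ‖seriesTerm α n m k‖ ≤ 2 * π * ((x / 2) ^ β * S) * (k : ℝ) ^ (-β) := by
    intro k hk
    have hk0 : (0 : ℝ) < k := by exact_mod_cast hk
    have e1 : 4 * π / (k : ℝ) * nu α n * mu α m = x / k := by
      rw [hx]
      ring
    have e2 : ‖2 * (π : ℂ) / (k : ℂ)‖ = 2 * π / k := by
      rw [norm_div, norm_mul, norm_real, Real.norm_of_nonneg hπ.le, norm_natCast]
      simp
    rw [seriesTerm, e1, norm_mul, norm_mul, e2, norm_real, Real.norm_eq_abs]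
    calc 2 * π / k * ‖kloosterman α k n m‖ * |besselI β (x / k)|
        ≤ 2 * π / k * k * ((x / 2) ^ β * S * (k : ℝ) ^ (-β)) := by
          gcongr
          · exact norm_kloosterman_le α k n m
          · exact hbes k hk
      _ = _ := by
          field_simp
  have hsum : Summable fun k : ℕ => 2 * π * ((x / 2) ^ β * S) * ((k + 1 : ℕ) : ℝ) ^ (-β) :=
    ((summable_nat_add_iff 1).mpr
      (Real.summable_nat_rpow.mpr (by linarith : -β < -1))).mul_left _
  exact hsum.of_norm_bounded fun k => hb _ k.succ_pos

/-- The finite form of the circle method: the partial sums up to the denominator `N` of the exact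
formula approximate `p α n` up to `O (N ^ (-α / 2))`. -/
theorem exists_norm_p_sub_le {α : ℝ} (hα : 0 < α) {n : ℕ} (hn : α / 24 < n) {M : ℕ}
    (hM : ∀ m, m < M → (m : ℝ) ≤ α / 24) (hM' : ∀ m, M ≤ m → α / 24 ≤ m) :
    ∃ C : ℝ, ∀ N : ℕ, 0 < N →
      ‖(p α n : ℂ) - ((nu α n ^ (-(α / 2) - 1) : ℝ) : ℂ) *
        ∑ m ∈ Finset.range M, ((mu α m ^ (α / 2 + 1) * p α m : ℝ) : ℂ) *
          ∑ k ∈ Finset.Icc 1 N, seriesTerm α n m k‖ ≤ C * (N : ℝ) ^ (-(α / 2)) := by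
  obtain ⟨C, hC⟩ := exists_norm_arc_integral_sub_le hα hn hM hM'
  refine ⟨C, fun N hN => ?_⟩
  have hN0 : (0 : ℝ) < N := by exact_mod_cast hN
  have hν : 0 < nu α n := Real.sqrt_pos.mpr (by linarith)
  obtain ⟨P, hPd, hPper⟩ := exists_primitive hα.le n
  obtain ⟨l, r, hlr, hsum⟩ := exists_ford_dissection hN
  have hp := hsum P (p α n) hPper
  let J : ℕ → ℕ → ℂ := fun k h => ∫ t in (-(l h k : ℝ))..(r h k),
    ((k : ℂ) + I * t) ^ ((-(α / 2 + 1 + 1) : ℝ) : ℂ) *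
      exp (((2 * π * nu α n ^ 2 / k : ℝ) : ℂ) / (k + I * t)) *
      (exp (α * π * (k + I * t) / (12 * k)) *
        genSeries α ((negInv h k + I * (k + I * t)) / k))
  let B : ℕ → ℕ → ℂ := fun k m => ((2 * π * (mu α m / nu α n) ^ (α / 2 + 1) *
    besselI (α / 2 + 1) (4 * π / k * nu α n * mu α m) : ℝ) : ℂ)
  have harc : ∀ k ∈ Finset.Icc 1 N, ∀ h ∈ (Finset.range k).filter (fun h => h.Coprime k),
      P (fordPoint h k (r h k)) - P (fordPoint h k (-(l h k : ℝ))) =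
        arcFactor α n h k / k * J k h := by
    intro k hk h hh
    have hk' : 0 < k := (Finset.mem_Icc.mp hk).1
    have hc := (Finset.mem_filter.mp hh).2
    have hd : ∀ t : ℝ, HasDerivAt (fun t : ℝ => P (fordPoint h k t))
        (genSeries α (fordPoint h k t) * exp (-(2 * π * I * n * fordPoint h k t)) *
          (1 / (k * ((k : ℂ) + I * t) ^ 2))) t := fun t =>
      (hPd _ (im_fordPoint h hk' t)).comp t (hasDerivAt_fordPoint h hk' t)
    have hcont : Continuous fun t : ℝ => genSeries α (fordPoint h k t) *
        exp (-(2 * π * I * n * fordPoint h k t)) * (1 / (k * ((k : ℂ) + I * t) ^ 2)) := by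
      have hf : Continuous (fordPoint h k) := continuous_iff_continuousAt.mpr fun t =>
        (hasDerivAt_fordPoint h hk' t).continuousAt
      have hg : Continuous fun t => genSeries α (fordPoint h k t) :=
        continuous_iff_continuousAt.mpr fun t => ContinuousAt.comp (g := genSeries α)
          (differentiableAt_genSeries α (im_fordPoint h hk' t)).continuousAt hf.continuousAt
      refine (hg.mul (by fun_prop)).mul (continuous_const.div (by fun_prop) fun t => ?_)
      exact mul_ne_zero (by exact_mod_cast hk'.ne')
        (pow_ne_zero _ (natCast_add_I_mul_ne_zero hk' t))
    rw [← intervalIntegral.integral_eq_sub_of_hasDerivAt (fun t _ => hd t)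
      (hcont.intervalIntegrable _ _)]
    simp only [J]
    rw [← intervalIntegral.integral_const_mul]
    exact intervalIntegral.integral_congr fun t _ => integrand_fordPoint hn hk' hc t
  have hmain : ((nu α n ^ (-(α / 2) - 1) : ℝ) : ℂ) *
      ∑ m ∈ Finset.range M, ((mu α m ^ (α / 2 + 1) * p α m : ℝ) : ℂ) *
        ∑ k ∈ Finset.Icc 1 N, seriesTerm α n m k =
      ∑ k ∈ Finset.Icc 1 N, ∑ h ∈ (Finset.range k).filter (fun h => h.Coprime k),
        arcFactor α n h k / k *
          ∑ m ∈ Finset.range M, (p α m : ℂ) * exp (2 * π * I * m * negInv h k / k) * B k m := by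
    simp only [Finset.mul_sum]
    rw [Finset.sum_comm]
    refine Finset.sum_congr rfl fun k _ => ?_
    rw [Finset.sum_comm]
    refine Finset.sum_congr rfl fun m _ => ?_
    have e : (mu α m / nu α n) ^ (α / 2 + 1) =
        nu α n ^ (-(α / 2) - 1) * mu α m ^ (α / 2 + 1) := by
      rw [Real.div_rpow (show 0 ≤ mu α m from Real.sqrt_nonneg _) hν.le,
        show -(α / 2) - 1 = -(α / 2 + 1) by ring, Real.rpow_neg hν.le]
      ring
    simp only [B, e]
    rw [seriesTerm, kloosterman_eq_sum_arcFactor, Finset.mul_sum, Finset.sum_mul, Finset.mul_sum,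
      Finset.mul_sum]
    refine Finset.sum_congr rfl fun h _ => ?_
    push_cast
    ring
  -- `C` is not known to be nonnegative, but it bounds a norm, for instance with `k = 1`.
  have hC0 : 0 ≤ C * (N : ℝ) ^ (-(α / 2 + 1)) := (norm_nonneg _).trans
    (hC N 1 (l 0 1) (r 0 1) 0 one_pos hN (hlr 1 (Finset.mem_Icc.mpr ⟨le_rfl, hN⟩) 0).1
      (hlr 1 (Finset.mem_Icc.mpr ⟨le_rfl, hN⟩) 0).2)
  rw [hmain, ← hp, Finset.sum_congr rfl fun k hk => Finset.sum_congr rfl (harc k hk),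
    ← Finset.sum_sub_distrib]
  have hk_bound : ∀ k ∈ Finset.Icc 1 N,
      ‖∑ h ∈ (Finset.range k).filter (fun h => h.Coprime k), arcFactor α n h k / k * J k h -
        ∑ h ∈ (Finset.range k).filter (fun h => h.Coprime k), arcFactor α n h k / k *
          ∑ m ∈ Finset.range M, (p α m : ℂ) * exp (2 * π * I * m * negInv h k / k) * B k m‖ ≤
      C * (N : ℝ) ^ (-(α / 2 + 1)) := by
    intro k hk
    have hk' := Finset.mem_Icc.mp hk
    have hk0 : (0 : ℝ) < k := by exact_mod_cast hk'.1
    rw [← Finset.sum_sub_distrib]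
    refine (norm_sum_le_of_le _ (n := fun _ => 1 / (k : ℝ) * (C * (N : ℝ) ^ (-(α / 2 + 1))))
      fun h _ => ?_).trans ?_
    · rw [← mul_sub, norm_mul, norm_div, norm_arcFactor, Complex.norm_natCast]
      exact mul_le_mul_of_nonneg_left (hC N k (l h k) (r h k) (negInv h k) hk'.1 hk'.2
        (hlr k hk h).1 (hlr k hk h).2) (by positivity)
    · rw [Finset.sum_const, nsmul_eq_mul, ← mul_assoc]
      refine mul_le_of_le_one_left hC0 ?_
      rw [mul_one_div, div_le_one hk0]
      exact_mod_cast (Finset.card_filter_le _ _).trans_eq (Finset.card_range k)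
  refine (norm_sum_le_of_le _ hk_bound).trans_eq ?_
  rw [Finset.sum_const, Nat.card_Icc, nsmul_eq_mul, Nat.add_sub_cancel,
    show -(α / 2 + 1) = -(α / 2) - 1 by ring, Real.rpow_sub_one hN0.ne']
  field_simp

lemma sum_Icc_one_eq_sum_range (g : ℕ → ℂ) (N : ℕ) :
    ∑ k ∈ Finset.Icc 1 N, g k = ∑ k ∈ Finset.range N, g (k + 1) := by
  rw [Finset.range_eq_Ico, Finset.sum_Ico_add' g 0 N 1]
  rfl

end FracPartition

theorem theorem1p1 (α : ℝ) (hα : 0 < α) (n : ℕ) (hn : α / 24 < (n : ℝ)) :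
    (∀ m ∈ Finset.range (⌊α / 24⌋₊ + 1),
      Summable fun k : ℕ => FracPartition.seriesTerm α n m (k + 1)) ∧
    (FracPartition.p α n : ℂ) =
      ((FracPartition.nu α n ^ (-(α / 2) - 1) : ℝ) : ℂ) *
        ∑ m ∈ Finset.range (⌊α / 24⌋₊ + 1),
          ((FracPartition.mu α m ^ (α / 2 + 1) * FracPartition.p α m : ℝ) : ℂ) *
            ∑' k : ℕ, FracPartition.seriesTerm α n m (k + 1) := by
  have hα24 : 0 ≤ α / 24 := by positivity
  have hM : ∀ m, m < ⌊α / 24⌋₊ + 1 → (m : ℝ) ≤ α / 24 := fun m hm =>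
    (Nat.le_floor_iff hα24).mp (Nat.lt_succ_iff.mp hm)
  have hM' : ∀ m : ℕ, ⌊α / 24⌋₊ + 1 ≤ m → α / 24 ≤ m := fun m hm =>
    (Nat.lt_of_floor_lt hm).le
  refine ⟨fun m _ => FracPartition.summable_seriesTerm hα n m, ?_⟩
  obtain ⟨C, hC⟩ := FracPartition.exists_norm_p_sub_le hα hn hM hM'
  have hlim : Tendsto (fun N : ℕ => ((FracPartition.nu α n ^ (-(α / 2) - 1) : ℝ) : ℂ) *
      ∑ m ∈ Finset.range (⌊α / 24⌋₊ + 1),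
        ((FracPartition.mu α m ^ (α / 2 + 1) * FracPartition.p α m : ℝ) : ℂ) *
          ∑ k ∈ Finset.Icc 1 N, FracPartition.seriesTerm α n m k) atTop
      (𝓝 (((FracPartition.nu α n ^ (-(α / 2) - 1) : ℝ) : ℂ) *
        ∑ m ∈ Finset.range (⌊α / 24⌋₊ + 1),
          ((FracPartition.mu α m ^ (α / 2 + 1) * FracPartition.p α m : ℝ) : ℂ) *
            ∑' k : ℕ, FracPartition.seriesTerm α n m (k + 1))) := by
    refine Tendsto.const_mul _ (tendsto_finsetSum _ fun m _ => Tendsto.const_mul _ ?_)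
    simp only [FracPartition.sum_Icc_one_eq_sum_range]
    exact (FracPartition.summable_seriesTerm hα n m).hasSum.tendsto_sum_nat
  have hlim' : Tendsto (fun N : ℕ => ((FracPartition.nu α n ^ (-(α / 2) - 1) : ℝ) : ℂ) *
      ∑ m ∈ Finset.range (⌊α / 24⌋₊ + 1),
        ((FracPartition.mu α m ^ (α / 2 + 1) * FracPartition.p α m : ℝ) : ℂ) *
          ∑ k ∈ Finset.Icc 1 N, FracPartition.seriesTerm α n m k) atTop
      (𝓝 (FracPartition.p α n : ℂ)) := by
    rw [tendsto_iff_norm_sub_tendsto_zero]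
    have h0 : Tendsto (fun N : ℕ => C * (N : ℝ) ^ (-(α / 2))) atTop (𝓝 0) := by
      simpa using ((tendsto_rpow_neg_atTop (by positivity : 0 < α / 2)).comp
        tendsto_natCast_atTop_atTop).const_mul C
    refine squeeze_zero' (Eventually.of_forall fun N => norm_nonneg _) ?_ h0
    filter_upwards [eventually_gt_atTop 0] with N hN
    rw [norm_sub_rev]
    exact hC N hN
  exact tendsto_nhds_unique hlim' hlim
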